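/- Let $1\le M\le N_d\le N$. There are $N$ robots and $M$ goals; $F=\{1,\dots,N\}\times\{1,\dots,M\}$ is the set of all robot–goal edges, and each edge $(i,j)$ carries a real random variable $C_{ij}$ (travel time) on a common probability space, with an arbitrary joint law. Let $O\subseteq F$ be an initial assignment: every goal lies in exactly one edge of $O$ and every robot in at most one. For $A\subseteq F_O:=F\setminus O$ let $$J_O(A)=\frac1M\sum_{j=1}^M \mathbb E\Big[\min\{C_{ij} : (i,j)\in A\cup O\}\Big],$$ where all these expectations are assumed to be finite, and let $J_0=J_O(\emptyset)$ be the cost of the non-redundant assignment, which is the maximum of $J_O$ on the subsets of $F_O$. Let $J_O^\star$ be the minimum of $J_O(A)$ over the $A\subseteq F_O$ with $|A|=N_d-M$ such that every robot lies in at most one edge of $A\cup O$ (feasible sets), and let $\mathcal I_O$ be the matroid of all $A\subseteq F_O$ with $|A|\le N_d-M$ such that every robot lies in at most one edge of $A\cup O$. (1) The greedy algorithm starts with $A=\emptyset$ and for $N_d$ iterations adds to $A$ an element $x\in F_O\setminus A$ with $A\cup\{x\}\in\mathcal I_O$ that maximizes $J_O(A)-J_O(A\cup\{x\})$ (ties are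 broken arbitrarily; nothing is added when no such $x$ exists). It returns a feasible set $A$, and $$J_O(A)\le \tfrac12\,(J_O^\star+J_0).$$ (2) Let $\varepsilon>0$. Apply to $Q(A)=J_0-J_O(A)$ the following randomized (accelerated) continuous greedy algorithm over $\mathcal I_O$. Put $n=|F_O|$, $r=N_d-M$, $k=\lceil 20/\varepsilon\rceil$, $\delta=1/k$, $m=\lceil 20\,r\,k^2\ln(nk)\rceil$, and fix an enumeration of $F_O$. Start from $x=0\in[0,1]^{F_O}$. In each of $k$ steps find a set $B\in\mathcal I_O$ by decreasing thresholds and replace $x$ by $x+\delta 1_B$: start with $B=\emptyset$, let $d$ be the largest $Q(\{e\})$ with $\{e\}\in\mathcal I_O$, and for $w=d,(1-\delta)d,(1-\delta)^2d,\dots$ as long as $w\ge\delta d/r$, scan the elements $e\in F_O$ and add $e$ to $B$ if $e\notin B$, $B\cup\{e\}\in\mathcal I_O$, and the average of $m$ independent samples of $Q(R\cup\{e\})-Q(R)$ is at least $w$, where the random set $R$ contains each $e'$ independently with probability $(x+\delta 1_B)_{e'}$ (no thresholds are used if $r=0$). Finally extend the $k$ sets found to bases of $\mathcal I_O$ and round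 their average by swap rounding: merge the bases one after the other, where two bases $B_1,B_2$ of weights $\beta_1,\beta_2$ are merged by repeatedly taking $i\in B_1\setminus B_2$, $j\in B_2\setminus B_1$ with $B_1-i+j,\ B_2-j+i\in\mathcal I_O$ and, with probability $\beta_1/(\beta_1+\beta_2)$, replacing $B_2$ by $B_2-j+i$, and otherwise $B_1$ by $B_1-i+j$, until $B_1=B_2$. The random set $A$ that is returned is always feasible, and $$\mathbb E\,[J_O(A)]\le\Big(1-\frac1e-\varepsilon\Big)J_O^\star+\Big(\frac1e+\varepsilon\Big)J_0 ,$$ where the expectation is over the random choices of the algorithm. -/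

import Mathlib

open MeasureTheory

/-! ### Randomized continuous greedy over an independence oracle and a value oracle -/

namespace ContinuousGreedy

variable {E : Type*} [DecidableEq E]

/-- A coin that shows `true` with probability `p` (`p` is clamped to `[0, 1]`). -/
noncomputable def coin (p : ℝ) : PMF Bool :=
  PMF.ofFintype
    (fun b => bif b then ENNReal.ofReal (max 0 (min p 1)) else ENNReal.ofReal (1 - max 0 (min p 1)))
    (by
      have h0 : (0 : ℝ) ≤ max 0 (min p 1) := le_max_left _ _
      have h1 : max 0 (min p 1) ≤ (1 : ℝ) := max_le zero_le_one (min_le_right _ _)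
      rw [Fintype.sum_bool]
      simp only [cond_true, cond_false]
      rw [← ENNReal.ofReal_add h0 (by linarith), add_sub_cancel, ENNReal.ofReal_one])

/-- The random set `R(y)`: every element `e` of the list is included independently with
probability `y e`. -/
noncomputable def randomSet (y : E → ℝ) : List E → PMF (Finset E)
  | [] => PMF.pure ∅
  | e :: l => (coin (y e)).bind fun b =>
      (randomSet y l).bind fun R => PMF.pure (if b then insert e R else R)

/-- The sum of `m` independent samples of the marginal value `f (R ∪ {e}) - f R`, `R ∼ R(y)`. -/
noncomputable def marginalSum (f : Finset E → ℝ) (order : List E) (y : E → ℝ) (e : E) :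
    ℕ → PMF ℝ
  | 0 => PMF.pure 0
  | m + 1 => (randomSet y order).bind fun R =>
      (marginalSum f order y e m).bind fun s => PMF.pure (s + (f (insert e R) - f R))

/-- The estimate of the expected marginal value of `e` at `R(y)`: the average of `m` samples. -/
noncomputable def marginalEstimate (f : Finset E → ℝ) (order : List E) (y : E → ℝ) (e : E)
    (m : ℕ) : PMF ℝ :=
  (marginalSum f order y e m).bind fun s => PMF.pure (s / m)

/-- The fractional point `(1 / k) * ∑ 1_B` over the sets `B` of a list. -/
noncomputable def fractionalPoint (k : ℕ) (Bs : List (Finset E)) (e : E) : ℝ :=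
  (Bs.countP fun B => decide (e ∈ B) : ℕ) / (k : ℝ)

/-- One pass over the elements at threshold `w`. The current fractional point `x` is given by the
sets `Bs`; each `e` is added to `B` if `B + e` is independent and the estimated marginal
value of `e` at `R(x + (1 / k) 1_B)` is at least `w`. -/
noncomputable def thresholdPass (I : Finset E → Prop) [DecidablePred I] (f : Finset E → ℝ)
    (order : List E) (k m : ℕ) (Bs : List (Finset E)) (w : ℝ) :
    List E → Finset E → PMF (Finset E)
  | [], B => PMF.pure B
  | e :: l, B => (marginalEstimate f order (fractionalPoint k (B :: Bs)) e m).bind fun v =>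
      thresholdPass I f order k m Bs w l
        (if e ∉ B ∧ I (insert e B) ∧ w ≤ v then insert e B else B)

/-- The passes at a list of thresholds, one after the other. -/
noncomputable def thresholdPasses (I : Finset E → Prop) [DecidablePred I] (f : Finset E → ℝ)
    (order : List E) (k m : ℕ) (Bs : List (Finset E)) : List ℝ → Finset E → PMF (Finset E)
  | [], B => PMF.pure B
  | w :: ws, B => (thresholdPass I f order k m Bs w order B).bind fun B' =>
      thresholdPasses I f order k m Bs ws B'

/-- The largest value of an element that is independent on its own (`0` if there is none). -/
noncomputable def maxSingleton (I : Finset E → Prop) [DecidablePred I] (f : Finset E → ℝ)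
    (order : List E) : ℝ :=
  order.foldr (fun e d => if I {e} then max (f {e}) d else d) 0

/-- The thresholds `d, (1 - δ) d, (1 - δ)² d, …`, down to `(δ / r) d`, for `δ = 1 / k`. -/
noncomputable def thresholds (d : ℝ) (r k : ℕ) : List ℝ :=
  (List.range (sInf {s : ℕ | (1 - 1 / (k : ℝ)) ^ s < 1 / (k : ℝ) / (r : ℝ)})).map
    fun s => (1 - 1 / (k : ℝ)) ^ s * d

/-- The Decreasing-Threshold procedure, started from `B = ∅`. -/
noncomputable def decreasingThreshold (I : Finset E → Prop) [DecidablePred I] (f : Finset E → ℝ)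
    (order : List E) (r k m : ℕ) (Bs : List (Finset E)) : PMF (Finset E) :=
  thresholdPasses I f order k m Bs (thresholds (maxSingleton I f order) r k) ∅

/-- `t` steps of the continuous greedy process with step size `1 / k`. The list of the sets
found so far represents the fractional point `(1 / k) * ∑ 1_B`. -/
noncomputable def steps (I : Finset E → Prop) [DecidablePred I] (f : Finset E → ℝ)
    (order : List E) (r k m : ℕ) : ℕ → PMF (List (Finset E))
  | 0 => PMF.pure []
  | t + 1 => (steps I f order r k m t).bind fun Bs =>
      (decreasingThreshold I f order r k m Bs).bind fun B => PMF.pure (B :: Bs)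

/-- Extension of an independent set to a base, by scanning the elements once. -/
def extendToBase (I : Finset E → Prop) [DecidablePred I] (order : List E) (B : Finset E) :
    Finset E :=
  order.foldl (fun B e => if I (insert e B) then insert e B else B) B

/-- The first pair `(i, j)` with `i ∈ B₁ \ B₂`, `j ∈ B₂ \ B₁` such that `B₁ - i + j` and
`B₂ - j + i` are both independent. -/
def exchangePair (I : Finset E → Prop) [DecidablePred I] (order : List E) (B₁ B₂ : Finset E) :
    Option (E × E) :=
  (order.product order).find? fun p =>
    decide (p.1 ∈ B₁ \ B₂ ∧ p.2 ∈ B₂ \ B₁ ∧ I (insert p.2 (B₁.erase p.1)) ∧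
      I (insert p.1 (B₂.erase p.2)))

/-- Merging of two bases with weights `β₁, β₂` in at most the given number of exchanges:
for an exchange pair `(i, j)`, with probability `β₁ / (β₁ + β₂)` replace `B₂` by `B₂ - j + i`,
and otherwise replace `B₁` by `B₁ - i + j`, until the two bases agree. -/
noncomputable def mergeBases (I : Finset E → Prop) [DecidablePred I] (order : List E)
    (β₁ β₂ : ℝ) : ℕ → Finset E → Finset E → PMF (Finset E)
  | 0, B₁, _ => PMF.pure B₁
  | s + 1, B₁, B₂ =>
      match exchangePair I order B₁ B₂ with
      | none => PMF.pure B₁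
      | some (i, j) => (coin (β₁ / (β₁ + β₂))).bind fun b =>
          if b then mergeBases I order β₁ β₂ s B₁ (insert i (B₂.erase j))
          else mergeBases I order β₁ β₂ s (insert j (B₁.erase i)) B₂

/-- The remaining merges of swap rounding, where `C` is the result of merging the first `l`
of a list of bases of equal weight and the other bases are still to come. -/
noncomputable def swapRoundFrom (I : Finset E → Prop) [DecidablePred I] (order : List E) :
    ℕ → Finset E → List (Finset E) → PMF (Finset E)
  | _, C, [] => PMF.pure C
  | l, C, B :: Bs => (mergeBases I order l 1 (C \ B).card C B).bind fun C' =>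
      swapRoundFrom I order (l + 1) C' Bs

/-- Swap rounding of the uniform convex combination of a list of bases. -/
noncomputable def swapRound (I : Finset E → Prop) [DecidablePred I] (order : List E) :
    List (Finset E) → PMF (Finset E)
  | [] => PMF.pure ∅
  | B :: Bs => swapRoundFrom I order 1 B Bs

/-- The accelerated continuous greedy algorithm for the maximization of `f` over the independent
sets of a matroid of rank `r`, on the ground set enumerated by `order`, with `k` steps (hence
step size and threshold ratio `δ = 1 / k`) and `m` samples for each estimate: run the
continuous greedy process, extend the sets found to bases, and round by swap rounding. -/
noncomputable def run (I : Finset E → Prop) [DecidablePred I] (f : Finset E → ℝ)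
    (order : List E) (r k m : ℕ) : PMF (Finset E) :=
  (steps I f order r k m k).bind fun Bs =>
    swapRound I order (Bs.map (extendToBase I order))

/-- The number of steps used for accuracy `ε`. -/
noncomputable def stepCount (ε : ℝ) : ℕ := ⌈20 / ε⌉₊

/-- The number of samples for each estimate, `O(r log (n / δ) / δ²)` for a ground set of size `n`,
a matroid of rank `r`, and step size `δ = 1 / k`. -/
noncomputable def sampleCount (n r k : ℕ) : ℕ :=
  ⌈20 * (r : ℝ) * (k : ℝ) ^ 2 * Real.log ((n : ℝ) * (k : ℝ))⌉₊

/-- The law of the output of the algorithm at accuracy `ε`. -/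
noncomputable def output (I : Finset E → Prop) [DecidablePred I] (f : Finset E → ℝ)
    (order : List E) (r : ℕ) (ε : ℝ) : PMF (Finset E) :=
  run I f order r (stepCount ε) (sampleCount order.length r (stepCount ε))

end ContinuousGreedy

/-! ### Redundant assignment of robots to goals -/

namespace RedundantAssignment

variable {N M : ℕ}

/-- Edges of the complete bipartite graph between robots and goals. -/
abbrev Edge (N M : ℕ) : Type := Fin N × Fin M

/-- Every goal is assigned exactly one robot, every robot at most one goal. -/
def IsInitialAssignment (O : Finset (Edge N M)) : Prop :=
  (∀ j : Fin M, (Finset.univ.filter fun i : Fin N => (i, j) ∈ O).card = 1) ∧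
    ∀ i : Fin N, (Finset.univ.filter fun j : Fin M => (i, j) ∈ O).card ≤ 1

/-- The edges of `S` incident to goal `j`. -/
def incident (S : Finset (Edge N M)) (j : Fin M) : Finset (Edge N M) :=
  S.filter fun e => e.2 = j

variable {Ω : Type*} [MeasurableSpace Ω]

/-- Effective waiting time: the minimum of the costs of the edges of `S`
(the value `0` for `S = ∅` is never used, as every goal is covered). -/
def effectiveWait (C : Fin N → Fin M → Ω → ℝ) (S : Finset (Edge N M)) (ω : Ω) : ℝ :=
  if h : S.Nonempty then S.inf' h (fun e => C e.1 e.2 ω) else 0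

/-- The objective: the average over the goals of the expected effective waiting time
under the assignment `A ∪ O`. -/
noncomputable def cost (P : Measure Ω) (C : Fin N → Fin M → Ω → ℝ) (O A : Finset (Edge N M)) : ℝ :=
  1 / (M : ℝ) * ∑ j : Fin M, ∫ ω, effectiveWait C (incident (A ∪ O) j) ω ∂P

/-- The ground set: all edges outside of `O`. -/
def ground (O : Finset (Edge N M)) : Finset (Edge N M) := Finset.univ \ O

/-- Every robot is assigned to at most one goal by `S`. -/
def RobotsOnce (S : Finset (Edge N M)) : Prop :=
  ∀ i : Fin N, (Finset.univ.filter fun j : Fin M => (i, j) ∈ S).card ≤ 1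

instance : DecidablePred (RobotsOnce (N := N) (M := M)) := fun S => by
  unfold RobotsOnce; infer_instance

/-- The feasible redundant assignments, which deploy exactly `Nd` robots together with `O`. -/
def Feasible (Nd : ℕ) (O A : Finset (Edge N M)) : Prop :=
  A ⊆ ground O ∧ RobotsOnce (A ∪ O) ∧ A.card = Nd - M

/-- The independent sets of the matroid constraint. -/
def Indep (Nd : ℕ) (O A : Finset (Edge N M)) : Prop :=
  A ⊆ ground O ∧ A.card ≤ Nd - M ∧ RobotsOnce (A ∪ O)

instance (Nd : ℕ) (O : Finset (Edge N M)) : DecidablePred (Indep Nd O) := fun A => by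
  unfold Indep; infer_instance

/-- The optimal value of the assignment problem. -/
noncomputable def optimalCost (P : Measure Ω) (C : Fin N → Fin M → Ω → ℝ) (Nd : ℕ)
    (O : Finset (Edge N M)) : ℝ :=
  sInf (cost P C O '' {A | Feasible Nd O A})

/-- The cost of the non-redundant assignment. -/
noncomputable def baseCost (P : Measure Ω) (C : Fin N → Fin M → Ω → ℝ)
    (O : Finset (Edge N M)) : ℝ :=
  cost P C O ∅

/-- The marginal decrease of the cost when `x` is added to `A`. -/
noncomputable def marginalDecrease (P : Measure Ω) (C : Fin N → Fin M → Ω → ℝ)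
    (O A : Finset (Edge N M)) (x : Edge N M) : ℝ :=
  cost P C O A - cost P C O (insert x A)

/-- The elements that can be added to `A`. -/
def eligible (Nd : ℕ) (O A : Finset (Edge N M)) : Finset (Edge N M) :=
  (ground O \ A).filter fun x => Indep Nd O (insert x A)

/-- `GreedyRun P C Nd O t A`: the greedy algorithm can hold the set `A` after `t` iterations.
Each iteration adds an eligible element of largest marginal decrease, with arbitrary choices
among ties, and nothing when no element is eligible. -/
inductive GreedyRun (P : Measure Ω) (C : Fin N → Fin M → Ω → ℝ) (Nd : ℕ) (O : Finset (Edge N M)) :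
    ℕ → Finset (Edge N M) → Prop
  | init : GreedyRun P C Nd O 0 ∅
  | add (t : ℕ) (A : Finset (Edge N M)) (a : Edge N M) (hA : GreedyRun P C Nd O t A)
      (ha : a ∈ eligible Nd O A)
      (hmax : ∀ x ∈ eligible Nd O A,
        marginalDecrease P C O A x ≤ marginalDecrease P C O A a) :
      GreedyRun P C Nd O (t + 1) (insert a A)
  | idle (t : ℕ) (A : Finset (Edge N M)) (hA : GreedyRun P C Nd O t A)
      (hnone : eligible Nd O A = ∅) : GreedyRun P C Nd O (t + 1) A

/-- The sets that the greedy algorithm, which makes `Nd` iterations, can return. -/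
def GreedyOutput (P : Measure Ω) (C : Fin N → Fin M → Ω → ℝ) (Nd : ℕ)
    (O A : Finset (Edge N M)) : Prop :=
  GreedyRun P C Nd O Nd A

/-- The law of the set returned by the randomized continuous greedy algorithm at accuracy `ε`,
applied to the cost reduction `A ↦ J₀ - J(A)` under the matroid constraint. -/
noncomputable def continuousGreedyOutput (P : Measure Ω) (C : Fin N → Fin M → Ω → ℝ) (Nd : ℕ)
    (O : Finset (Edge N M)) (order : List (Edge N M)) (ε : ℝ) : PMF (Finset (Edge N M)) :=
  ContinuousGreedy.output (Indep Nd O) (fun A => baseCost P C O - cost P C O A)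
    order (Nd - M) ε

end RedundantAssignment

/-! The cost reduction `Q = J₀ - J` is monotone and submodular for a pathwise reason: in each
outcome, a new edge of cost `c` lowers the waiting time `w` of its goal by `max 0 (w - c)`, which is
monotone in `w`, and `w` only shrinks as the assignment grows. Expectations and averages preserve
this, so the joint law is irrelevant. The constraint is a truncated partition matroid whose bases
are the feasible sets. Both guarantees are thus bounds for monotone submodular maximization over a
matroid, read back through `J = J₀ - Q`.

One charging argument serves both algorithms. When a set is built greedily, matroid augmentation
matches each added element with an element of a competitor `T` that was available at that moment
(`GreedyChain.sum_le_of_card_eq`). With exact marginal values this yields `f T ≤ 2 * f B`.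

In the continuous process the potential is the multilinear extension `F`. Decreasing thresholds and
sampled marginals make every choice greedy up to a factor `1 - 3δ` and an additive error `3δd/r`,
where `δ = 1/k`. One step from `x` to `x'` then satisfies `(1 + (1 - 3δ)δ)(f T - F x') ≤ f T - F x +
3δ² f T` (`decreasingThreshold_holds`), and `k` steps leave a gap of at most `(1/e + 7δ) f T`. A
Chernoff bound for the estimates (`marginalEstimate_accurate`) and a union bound
(`total_failure_le`) limit the failure probability to `δ`.

Rounding loses nothing in expectation: each exchange moves the fractional point along `1_i - 1_j`
with mean zero, and `F` is convex in these directions (`le_multilinear_swap`, `le_mean_mergeBases`).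
-/

namespace ContinuousGreedy

open scoped ENNReal

/-! ### Expectations and failure probabilities for discrete distributions -/

section Mean

variable {α β : Type*}

/-- The expectation of a nonnegative function under a discrete distribution. -/
noncomputable def mean (p : PMF α) (g : α → ℝ≥0∞) : ℝ≥0∞ := ∑' a, p a * g a

theorem mean_pure (a : α) (g : α → ℝ≥0∞) : mean (PMF.pure a) g = g a := by
  unfold mean
  rw [tsum_eq_single a]
  · simp
  · intro b hb
    simp [PMF.pure_apply, hb]

theorem mean_bind (p : PMF α) (q : α → PMF β) (g : β → ℝ≥0∞) :
    mean (p.bind q) g = mean p fun a => mean (q a) g := by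
  unfold mean
  simp only [PMF.bind_apply, ← ENNReal.tsum_mul_right, ← ENNReal.tsum_mul_left]
  rw [ENNReal.tsum_comm]
  simp only [mul_assoc]

theorem mean_const (p : PMF α) (c : ℝ≥0∞) : mean p (fun _ => c) = c := by
  unfold mean
  rw [ENNReal.tsum_mul_right, p.tsum_coe, one_mul]

theorem mean_add (p : PMF α) (g h : α → ℝ≥0∞) :
    mean p (fun a => g a + h a) = mean p g + mean p h := by
  unfold mean
  simp only [mul_add]
  exact ENNReal.tsum_add

theorem mean_mul_left (p : PMF α) (c : ℝ≥0∞) (g : α → ℝ≥0∞) :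
    mean p (fun a => c * g a) = c * mean p g := by
  unfold mean
  rw [← ENNReal.tsum_mul_left]
  exact tsum_congr fun a => mul_left_comm _ _ _

theorem mean_mul_right (p : PMF α) (c : ℝ≥0∞) (g : α → ℝ≥0∞) :
    mean p (fun a => g a * c) = mean p g * c := by
  simp only [mul_comm _ c, mean_mul_left]

theorem mean_le_mean_of_support (p : PMF α) {g h : α → ℝ≥0∞} (H : ∀ a ∈ p.support, g a ≤ h a) :
    mean p g ≤ mean p h := by
  refine ENNReal.tsum_le_tsum fun a => ?_
  by_cases ha : p a = 0
  · simp [ha]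
  · exact mul_le_mul_right (H a ((p.mem_support_iff a).2 ha)) _

theorem mean_le_mean (p : PMF α) {g h : α → ℝ≥0∞} (H : ∀ a, g a ≤ h a) : mean p g ≤ mean p h :=
  mean_le_mean_of_support p fun a _ => H a

theorem mean_coin {t : ℝ} (h0 : 0 ≤ t) (h1 : t ≤ 1) (g : Bool → ℝ≥0∞) :
    mean (coin t) g = ENNReal.ofReal t * g true + ENNReal.ofReal (1 - t) * g false := by
  unfold mean coin
  rw [tsum_bool, add_comm]
  simp [PMF.ofFintype_apply, h0, h1]

open Classical in
/-- The predicate `Q` holds up to an event of probability at most `η`. -/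
def HoldsUpTo (p : PMF α) (η : ℝ≥0∞) (Q : α → Prop) : Prop :=
  mean p (fun a => if Q a then 0 else 1) ≤ η

/-- The union bound for consecutive random stages: the second stage need only be controlled after
the first has succeeded. -/
theorem HoldsUpTo.bind {p : PMF α} {q : α → PMF β} {η η' : ℝ≥0∞} {Q : α → Prop} {Q' : β → Prop}
    (h : HoldsUpTo p η Q) (h' : ∀ a, Q a → HoldsUpTo (q a) η' Q') :
    HoldsUpTo (p.bind q) (η + η') Q' := by
  classical
  unfold HoldsUpTo at *
  rw [mean_bind]
  calc _ ≤ mean p (fun a => (if Q a then 0 else 1) + η') := by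
        refine mean_le_mean p fun a => ?_
        by_cases ha : Q a
        · simpa [ha] using h' a ha
        · simp only [ha, if_false]
          refine le_trans ?_ le_self_add
          calc _ ≤ mean (q a) (fun _ => 1) := mean_le_mean _ fun b => by split_ifs <;> simp
            _ = 1 := mean_const _ _
    _ ≤ _ := by
        rw [mean_add, mean_const]
        exact add_le_add_left h _

theorem HoldsUpTo.pure {a : α} {Q : α → Prop} (h : Q a) (η : ℝ≥0∞) :
    HoldsUpTo (PMF.pure a) η Q := by
  unfold HoldsUpTo
  rw [mean_pure]
  simp [h]

theorem HoldsUpTo.mono {p : PMF α} {η η' : ℝ≥0∞} {Q Q' : α → Prop} (h : HoldsUpTo p η Q)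
    (hη : η ≤ η') (hQ : ∀ a, Q a → Q' a) : HoldsUpTo p η' Q' := by
  unfold HoldsUpTo at *
  refine le_trans (mean_le_mean p fun a => ?_) (h.trans hη)
  by_cases ha : Q a
  · simp [ha, hQ a ha]
  · split_ifs <;> simp

theorem HoldsUpTo.and {p : PMF α} {η η' : ℝ≥0∞} {Q Q' : α → Prop} (h : HoldsUpTo p η Q)
    (h' : HoldsUpTo p η' Q') : HoldsUpTo p (η + η') fun a => Q a ∧ Q' a := by
  unfold HoldsUpTo at *
  refine le_trans (mean_le_mean p fun a => ?_) ((mean_add p _ _).trans_le (add_le_add h h'))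
  by_cases ha : Q a <;> by_cases hb : Q' a <;> simp [ha, hb]

/-- Markov's inequality. -/
theorem holdsUpTo_of_mean_le {p : PMF α} {η : ℝ≥0∞} {g : α → ℝ≥0∞} (h : mean p g ≤ η) :
    HoldsUpTo p η fun a => g a < 1 := by
  unfold HoldsUpTo
  refine le_trans (mean_le_mean p fun a => ?_) h
  split_ifs with ha
  · simp
  · exact not_lt.1 ha

/-- On the failure event the nonnegative `g` is bounded below by `0` only, which costs at most `c *
η`. The loss stands on the right to avoid truncated subtraction. -/
theorem HoldsUpTo.le_mean {p : PMF α} {η c : ℝ≥0∞} {Q : α → Prop} {g : α → ℝ≥0∞}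
    (h : HoldsUpTo p η Q) (hg : ∀ a ∈ p.support, Q a → c ≤ g a) : c ≤ mean p g + c * η := by
  classical
  unfold HoldsUpTo at h
  calc c = mean p (fun _ => c) := (mean_const p c).symm
    _ ≤ mean p (fun a => g a + c * (if Q a then 0 else 1)) := by
        refine mean_le_mean_of_support p fun a ha => ?_
        by_cases hQ : Q a
        · simpa [hQ] using hg a ha hQ
        · simp [hQ]
    _ ≤ _ := by
        rw [mean_add, mean_mul_left]
        exact add_le_add_right (mul_le_mul_right h c) _

end Mean

/-! ### The multilinear extension -/

section Multilinear

variable {E : Type*} [DecidableEq E]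

/-- The multilinear extension of the set function `g` on the ground set `l`, at the point `y`. -/
def multilinear (y : E → ℝ) : List E → (Finset E → ℝ) → ℝ
  | [], g => g ∅
  | e :: l, g => y e * multilinear y l (fun R => g (insert e R)) + (1 - y e) * multilinear y l g

theorem multilinear_const (y : E → ℝ) (l : List E) (c : ℝ) : multilinear y l (fun _ => c) = c := by
  induction l with
  | nil => rfl
  | cons e l ih => simp only [multilinear, ih]; ring

theorem multilinear_add (y : E → ℝ) (l : List E) (g h : Finset E → ℝ) :
    multilinear y l (fun R => g R + h R) = multilinear y l g + multilinear y l h := by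
  induction l generalizing g h with
  | nil => rfl
  | cons e l ih => simp only [multilinear, ih]; ring

theorem multilinear_const_mul (y : E → ℝ) (l : List E) (c : ℝ) (g : Finset E → ℝ) :
    multilinear y l (fun R => c * g R) = c * multilinear y l g := by
  induction l generalizing g with
  | nil => rfl
  | cons e l ih => simp only [multilinear, ih]; ring

theorem multilinear_sub (y : E → ℝ) (l : List E) (g h : Finset E → ℝ) :
    multilinear y l (fun R => g R - h R) = multilinear y l g - multilinear y l h := by
  induction l generalizing g h with
  | nil => rfl
  | cons e l ih => simp only [multilinear, ih]; ring

theorem multilinear_sum {ι : Type*} (y : E → ℝ) (l : List E) (T : Finset ι)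
    (g : ι → Finset E → ℝ) :
    multilinear y l (fun R => ∑ i ∈ T, g i R) = ∑ i ∈ T, multilinear y l (g i) := by
  classical
  induction T using Finset.induction_on with
  | empty => simp [multilinear_const]
  | insert a s ha ih => simp only [Finset.sum_insert ha, multilinear_add, ih]

theorem multilinear_congr (y : E → ℝ) {l : List E} {g h : Finset E → ℝ}
    (H : ∀ R ⊆ l.toFinset, g R = h R) : multilinear y l g = multilinear y l h := by
  induction l generalizing g h with
  | nil => exact H ∅ (by simp)
  | cons e l ih =>
    simp only [multilinear]
    rw [ih (g := g) (h := h), ih (g := fun R => g (insert e R)) (h := fun R => h (insert e R))]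
    · intro R hR
      refine H _ ?_
      rw [List.toFinset_cons]
      exact Finset.insert_subset_insert _ hR
    · intro R hR
      refine H _ (hR.trans ?_)
      rw [List.toFinset_cons]
      exact Finset.subset_insert _ _

theorem multilinear_mono {y : E → ℝ} {l : List E} (h0 : ∀ e, 0 ≤ y e) (h1 : ∀ e, y e ≤ 1)
    {g h : Finset E → ℝ} (H : ∀ R, g R ≤ h R) : multilinear y l g ≤ multilinear y l h := by
  induction l generalizing g h with
  | nil => exact H ∅
  | cons e l ih =>
    simp only [multilinear]
    exact add_le_add (mul_le_mul_of_nonneg_left (ih fun R => H _) (h0 e))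
      (mul_le_mul_of_nonneg_left (ih H) (sub_nonneg.2 (h1 e)))

/-- Raising a coordinate moves weight from the branch without `e` to the branch with it, which is
the larger one for monotone `g`. -/
theorem multilinear_le_of_point_le {y z : E → ℝ} {l : List E} (h0 : ∀ e, 0 ≤ y e)
    (h1 : ∀ e, z e ≤ 1) (hyz : ∀ e, y e ≤ z e) {g : Finset E → ℝ} (hg : Monotone g) :
    multilinear y l g ≤ multilinear z l g := by
  induction l generalizing g with
  | nil => exact le_rfl
  | cons e l ih =>
    simp only [multilinear]
    have hins : Monotone fun R => g (insert e R) := fun R S h =>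
      hg (Finset.insert_subset_insert _ h)
    have a := ih hins
    have b := ih hg
    have c : multilinear y l g ≤ multilinear y l (fun R => g (insert e R)) :=
      multilinear_mono h0 (fun e => (hyz e).trans (h1 e)) fun R => hg (Finset.subset_insert _ _)
    have := h0 e
    have := h1 e
    have := hyz e
    nlinarith

theorem multilinear_antitone {y z : E → ℝ} {l : List E} (h0 : ∀ e, 0 ≤ y e)
    (h1 : ∀ e, z e ≤ 1) (hyz : ∀ e, y e ≤ z e) {g : Finset E → ℝ} (hg : Antitone g) :
    multilinear z l g ≤ multilinear y l g := by
  have := multilinear_le_of_point_le (l := l) h0 h1 hyz (g := fun R => -1 * g R)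
    fun R S h => by have := hg h; dsimp only; linarith
  rw [multilinear_const_mul, multilinear_const_mul] at this
  linarith

/-- A coordinate matters only if the function depends on it. This allows a comparison of points that
differ in a few coordinates once these have been split off. -/
theorem multilinear_congr_point {y z : E → ℝ} {l : List E} {g : Finset E → ℝ}
    (H : ∀ e, y e = z e ∨ ∀ R, g (insert e R) = g R) : multilinear y l g = multilinear z l g := by
  induction l generalizing g with
  | nil => rfl
  | cons a l ih =>
    simp only [multilinear]
    have h1 := ih H
    have h2 : multilinear y l (fun R => g (insert a R)) =
        multilinear z l (fun R => g (insert a R)) := by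
      refine ih fun e => (H e).imp_right fun h R => ?_
      rw [Finset.insert_comm, h]
    rcases H a with h | h
    · rw [h1, h2, h]
    · simp only [h] at *
      rw [h1]; ring

/-- The multilinear extension is affine in every coordinate. -/
theorem multilinear_split (y : E → ℝ) {l : List E} (hl : l.Nodup) {e : E} (he : e ∈ l)
    (g : Finset E → ℝ) :
    multilinear y l g = y e * multilinear y l (fun R => g (insert e R)) +
      (1 - y e) * multilinear y l (fun R => g (R.erase e)) := by
  induction l generalizing g with
  | nil => simp at he
  | cons a l ih =>
    have hal := (List.nodup_cons.1 hl).1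
    by_cases hae : a = e
    · subst hae
      simp only [multilinear, Finset.insert_idem]
      have h1 : multilinear y l (fun R => g ((insert a R).erase a)) = multilinear y l g :=
        multilinear_congr y fun R hR => by
          rw [Finset.erase_insert fun h => hal (List.mem_toFinset.1 (hR h))]
      have h2 : multilinear y l (fun R => g (R.erase a)) = multilinear y l g :=
        multilinear_congr y fun R hR => by
          rw [Finset.erase_eq_of_notMem fun h => hal (List.mem_toFinset.1 (hR h))]
      rw [h1, h2]; ring
    · have he' : e ∈ l := (List.mem_cons.1 he).resolve_left fun h => hae h.symm
      have ih' := ih (List.nodup_cons.1 hl).2 he'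
      simp only [multilinear]
      rw [ih' g, ih' fun R => g (insert a R)]
      simp only [Finset.erase_insert_of_ne hae, Finset.insert_comm a e]
      ring

theorem multilinear_indicator {l : List E} {A : Finset E} (hA : A ⊆ l.toFinset) (hl : l.Nodup)
    {y : E → ℝ} (hy : ∀ e, y e = if e ∈ A then 1 else 0) (g : Finset E → ℝ) :
    multilinear y l g = g A := by
  induction l generalizing A g y with
  | nil =>
    have : A = ∅ := by simpa using hA
    subst this
    rfl
  | cons a l ih =>
    have hal := (List.nodup_cons.1 hl).1
    rw [List.toFinset_cons] at hA
    simp only [multilinear]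
    by_cases ha : a ∈ A
    · have key : multilinear y l (fun R => g (insert a R)) = g (insert a (A.erase a)) := by
        rw [← ih (A := A.erase a) (y := fun e => if e ∈ A.erase a then 1 else 0) _
          (List.nodup_cons.1 hl).2 (fun _ => rfl) fun R => g (insert a R)]
        · refine multilinear_congr_point fun e => ?_
          by_cases hea : e = a
          · right; intro R; simp [hea]
          · left; simp [hy, hea]
        · intro x hx
          rw [Finset.mem_erase] at hx
          exact (Finset.mem_insert.1 (hA hx.2)).resolve_left hx.1
      rw [key, Finset.insert_erase ha, hy a, if_pos ha]; ring
    · rw [ih (A := A) (g := g) _ (List.nodup_cons.1 hl).2 hy, hy a, if_neg ha]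
      · ring
      · intro x hx
        exact (Finset.mem_insert.1 (hA hx)).resolve_left fun h => ha (h ▸ hx)

/-- Submodularity: the marginal values decrease. -/
def DecreasingMarginals (f : Finset E → ℝ) : Prop :=
  ∀ S T e, S ⊆ T → f (insert e T) - f T ≤ f (insert e S) - f S

/-- The multilinear extension of a submodular function is convex along `1_i - 1_j`. -/
theorem le_multilinear_swap {f : Finset E → ℝ} (hf : DecreasingMarginals f) {l : List E}
    (hl : l.Nodup) {i j : E} (hi : i ∈ l) (hj : j ∈ l) (hij : i ≠ j) {y y₁ y₂ : E → ℝ}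
    (h0 : ∀ e, 0 ≤ y e) (h1 : ∀ e, y e ≤ 1) {p q s t : ℝ} (hp : 0 ≤ p) (hq : 0 ≤ q)
    (hpq : p + q = 1) (hst : p * s = q * t) (h₁i : y₁ i = y i + s) (h₁j : y₁ j = y j - s)
    (h₁ : ∀ e, e ≠ i → e ≠ j → y₁ e = y e) (h₂i : y₂ i = y i - t) (h₂j : y₂ j = y j + t)
    (h₂ : ∀ e, e ≠ i → e ≠ j → y₂ e = y e) :
    multilinear y l f ≤ p * multilinear y₁ l f + q * multilinear y₂ l f := by
  set a := multilinear y l fun R => f (insert i (insert j R)) with ha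
  set b := multilinear y l fun R => f (insert i (R.erase j)) with hb
  set c := multilinear y l fun R => f ((insert j R).erase i) with hc
  set d := multilinear y l fun R => f ((R.erase j).erase i) with hd
  -- This is the mixed second difference in the coordinates `i` and `j`, averaged over the others;
  -- submodularity makes it nonpositive.
  have hsub : a + d - b - c ≤ 0 := by
    rw [ha, hb, hc, hd, ← multilinear_add, ← multilinear_sub, ← multilinear_sub,
      ← multilinear_const y l 0]
    refine multilinear_mono h0 h1 fun R => ?_
    have := hf ((R.erase j).erase i) (insert j ((R.erase j).erase i)) i (Finset.subset_insert _ _)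
    have e1 : insert i (insert j ((R.erase j).erase i)) = insert i (insert j R) := by
      ext x; simp only [Finset.mem_insert, Finset.mem_erase]; tauto
    have e2 : insert j ((R.erase j).erase i) = (insert j R).erase i := by
      ext x; simp only [Finset.mem_insert, Finset.mem_erase]
      by_cases hx : x = j
      · subst hx; simp [hij.symm]
      · simp [hx]
    have e3 : insert i ((R.erase j).erase i) = insert i (R.erase j) := by
      ext x; simp only [Finset.mem_insert, Finset.mem_erase]; tauto
    rw [e1, e2, e3] at this
    linarith
  have expand : ∀ z : E → ℝ, (∀ e, e ≠ i → e ≠ j → z e = y e) → multilinear z l f =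
      z i * (z j * a + (1 - z j) * b) + (1 - z i) * (z j * c + (1 - z j) * d) := by
    intro z hz
    have agree : ∀ g : Finset E → ℝ, (∀ R, g (insert i R) = g R) → (∀ R, g (insert j R) = g R) →
        multilinear z l g = multilinear y l g := by
      intro g hgi hgj
      refine multilinear_congr_point fun e => ?_
      by_cases hei : e = i
      · right; rw [hei]; exact hgi
      · by_cases hej : e = j
        · right; rw [hej]; exact hgj
        · left; exact hz e hei hej
    rw [multilinear_split z hl hi f, multilinear_split z hl hj fun R => f (insert i R),
      multilinear_split z hl hj fun R => f (R.erase i), ha, hb, hc, hd, agree, agree, agree, agree]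
    all_goals
      intro R
      congr 1
      ext x
      simp only [Finset.mem_insert, Finset.mem_erase]
      by_cases hxi : x = i
      · subst hxi; simp [hij]
      · by_cases hxj : x = j
        · subst hxj; simp [hxi]
        · simp [hxi, hxj]
  rw [expand y fun _ _ _ => rfl, expand y₁ h₁, expand y₂ h₂, h₁i, h₁j, h₂i, h₂j]
  have hq' : p = 1 - q := by linarith
  have : 0 ≤ (p * s ^ 2 + q * t ^ 2) * (-(a + d - b - c)) :=
    mul_nonneg (by positivity) (by linarith)
  have hst' : s - q * s = q * t := by rw [← hst, hq']; ring
  have h3 : ∀ K : ℝ, (s - q * s - q * t) * K = 0 := fun K => by rw [hst']; ring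
  -- The factor is the derivative of the extension along `1_i - 1_j` at `y`. The balance `p * s = q
  -- * t` cancels this first-order term and leaves only `-(p s² + q t²)` times the mixed difference.
  have h4 := h3 ((y j * a + (1 - y j) * b) - (y j * c + (1 - y j) * d) - y i * (a - b) -
    (1 - y i) * (c - d))
  subst hq'
  nlinarith

/-- This ties the sampler to the multilinear extension; nonnegativity is required because `mean`
takes values in `ℝ≥0∞`. -/
theorem mean_randomSet {y : E → ℝ} (h0 : ∀ e, 0 ≤ y e) (h1 : ∀ e, y e ≤ 1) (l : List E)
    {g : Finset E → ℝ} (hg : ∀ R, 0 ≤ g R) :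
    mean (randomSet y l) (fun R => ENNReal.ofReal (g R)) = ENNReal.ofReal (multilinear y l g) := by
  induction l generalizing g with
  | nil => simp [randomSet, multilinear, mean_pure]
  | cons e l ih =>
    have nonneg : ∀ {h : Finset E → ℝ}, (∀ R, 0 ≤ h R) → 0 ≤ multilinear y l h := fun hh => by
      have := multilinear_mono (l := l) h0 h1 hh
      rwa [multilinear_const] at this
    simp only [randomSet, multilinear, mean_bind, mean_pure]
    rw [mean_coin (h0 e) (h1 e)]
    simp only [if_true, Bool.false_eq_true, if_false]
    rw [ih hg, ih (g := fun R => g (insert e R)) fun R => hg _,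
      ← ENNReal.ofReal_mul (h0 e), ← ENNReal.ofReal_mul (sub_nonneg.2 (h1 e)), ENNReal.ofReal_add]
    · exact mul_nonneg (h0 e) (nonneg fun R => hg _)
    · exact mul_nonneg (sub_nonneg.2 (h1 e)) (nonneg hg)

end Multilinear

end ContinuousGreedy

namespace ContinuousGreedy

open scoped ENNReal

variable {E : Type*} [DecidableEq E]

/-! ### Concentration of the sampled marginal values -/

section Estimates

/-- For `u ∈ [0, 1]` and `|θ| ≤ 1` one has `exp (θ u) ≤ 1 + θ u + (θ u)² ≤ 1 + (θ + θ²) u`, which is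
linear in `u` and can be averaged. Independence of the samples multiplies the bounds. -/
theorem mean_marginalSum_exp {f : Finset E → ℝ} {y : E → ℝ} (h0 : ∀ e, 0 ≤ y e)
    (h1 : ∀ e, y e ≤ 1) {order : List E} {e : E} {d : ℝ} (hd : 0 < d)
    (hX0 : ∀ R, 0 ≤ f (insert e R) - f R) (hXd : ∀ R, f (insert e R) - f R ≤ d)
    {θ : ℝ} (hθ : |θ| ≤ 1) (m : ℕ) :
    mean (marginalSum f order y e m) (fun s => ENNReal.ofReal (Real.exp (θ * (s / d)))) ≤
      ENNReal.ofReal (Real.exp (m * ((θ + θ ^ 2) *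
        (multilinear y order (fun R => f (insert e R) - f R) / d)))) := by
  set μ := multilinear y order (fun R => f (insert e R) - f R) with hμ
  induction m with
  | zero => simp [marginalSum, mean_pure]
  | succ m ih =>
    have single : mean (randomSet y order) (fun R => ENNReal.ofReal
        (Real.exp (θ * ((f (insert e R) - f R) / d)))) ≤
        ENNReal.ofReal (Real.exp ((θ + θ ^ 2) * (μ / d))) := by
      rw [mean_randomSet h0 h1 order fun R => (Real.exp_pos _).le]
      refine ENNReal.ofReal_le_ofReal ?_
      calc _ ≤ multilinear y order (fun R => 1 + (θ + θ ^ 2) / d * (f (insert e R) - f R)) := by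
            refine multilinear_mono h0 h1 fun R => ?_
            set u := (f (insert e R) - f R) / d with hu
            have hu0 : 0 ≤ u := div_nonneg (hX0 R) hd.le
            have hu1 : u ≤ 1 := (div_le_one hd).2 (hXd R)
            have habs : |θ * u| ≤ 1 := by
              rw [abs_mul, abs_of_nonneg hu0]
              exact mul_le_one₀ hθ hu0 hu1
            have hexp := (abs_le.1 (Real.abs_exp_sub_one_sub_id_le habs)).2
            have e1 : (θ + θ ^ 2) / d * (f (insert e R) - f R) = (θ + θ ^ 2) * u := by
              rw [hu]; ring
            rw [e1]
            have : (θ * u) ^ 2 ≤ θ ^ 2 * u := by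
              rw [mul_pow]
              exact mul_le_mul_of_nonneg_left (by nlinarith) (sq_nonneg θ)
            nlinarith
        _ = (θ + θ ^ 2) * (μ / d) + 1 := by
            rw [multilinear_add, multilinear_const, multilinear_const_mul, ← hμ]; ring
        _ ≤ _ := Real.add_one_le_exp _
    simp only [marginalSum, mean_bind, mean_pure]
    have split : ∀ R s : ℝ, ENNReal.ofReal (Real.exp (θ * ((s + R) / d))) =
        ENNReal.ofReal (Real.exp (θ * (R / d))) * ENNReal.ofReal (Real.exp (θ * (s / d))) := by
      intro R s
      rw [← ENNReal.ofReal_mul (Real.exp_pos _).le, ← Real.exp_add]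
      congr 2; ring
    simp only [split, mean_mul_left, mean_mul_right]
    refine (mul_le_mul' single ih).trans (le_of_eq ?_)
    rw [← ENNReal.ofReal_mul (Real.exp_pos _).le, ← Real.exp_add]
    congr 2; push_cast; ring

/-- Markov's inequality for the exponential moment. Allowing either sign of `θ` gives both tails at
once. -/
theorem marginalSum_tail {f : Finset E → ℝ} {y : E → ℝ} (h0 : ∀ e, 0 ≤ y e)
    (h1 : ∀ e, y e ≤ 1) {order : List E} {e : E} {d : ℝ} (hd : 0 < d)
    (hX0 : ∀ R, 0 ≤ f (insert e R) - f R) (hXd : ∀ R, f (insert e R) - f R ≤ d)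
    {θ : ℝ} (hθ : |θ| ≤ 1) (m : ℕ) (c : ℝ) :
    HoldsUpTo (marginalSum f order y e m) (ENNReal.ofReal (Real.exp (-c))) fun s =>
      θ * s < m * ((θ + θ ^ 2) * multilinear y order (fun R => f (insert e R) - f R)) + c * d := by
  set μ := multilinear y order (fun R => f (insert e R) - f R) with hμ
  have key := mean_marginalSum_exp h0 h1 (order := order) hd hX0 hXd hθ m
  rw [← hμ] at key
  refine (holdsUpTo_of_mean_le (g := fun s =>
    ENNReal.ofReal (Real.exp (-(m * ((θ + θ ^ 2) * (μ / d))) - c)) *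
      ENNReal.ofReal (Real.exp (θ * (s / d)))) ?_).mono le_rfl fun s hs => ?_
  · rw [mean_mul_left]
    refine (mul_le_mul_right key _).trans (le_of_eq ?_)
    rw [← ENNReal.ofReal_mul (Real.exp_pos _).le, ← Real.exp_add]
    congr 2; ring
  · rw [← ENNReal.ofReal_mul (Real.exp_pos _).le, ← Real.exp_add, ENNReal.ofReal_lt_one,
      Real.exp_lt_one_iff] at hs
    have h2 := mul_lt_mul_of_pos_right hs hd
    have e1 : (-(m * ((θ + θ ^ 2) * (μ / d))) - c + θ * (s / d)) * d =
        -(m * ((θ + θ ^ 2) * μ)) - c * d + θ * s := by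
      field_simp
    rw [e1] at h2
    linarith

/-- The Chernoff bound with relative and additive error for the estimates. -/
theorem marginalEstimate_accurate {f : Finset E → ℝ} {y : E → ℝ} (h0 : ∀ e, 0 ≤ y e)
    (h1 : ∀ e, y e ≤ 1) {order : List E} {e : E} {d : ℝ} (hd : 0 < d)
    (hX0 : ∀ R, 0 ≤ f (insert e R) - f R) (hXd : ∀ R, f (insert e R) - f R ≤ d)
    {δ : ℝ} (hδ0 : 0 < δ) (hδ1 : δ ≤ 1) {m : ℕ} (hm : 0 < m) (β : ℝ) :
    HoldsUpTo (marginalEstimate f order y e m) (2 * ENNReal.ofReal (Real.exp (-(m * δ * β))))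
      fun v => (1 - δ) * multilinear y order (fun R => f (insert e R) - f R) - β * d ≤ v ∧
        v ≤ (1 + δ) * multilinear y order (fun R => f (insert e R) - f R) + β * d := by
  set μ := multilinear y order (fun R => f (insert e R) - f R) with hμ
  -- With `θ = ±δ` and exponent `m * δ * β`, division by `m * δ` turns the tail bounds into relative
  -- error `δ` and additive error `β * d`.
  have up := marginalSum_tail h0 h1 (order := order) hd hX0 hXd (θ := δ)
    (by rw [abs_of_pos hδ0]; exact hδ1) m (m * δ * β)
  have lo := marginalSum_tail h0 h1 (order := order) hd hX0 hXd (θ := -δ)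
    (by rw [abs_neg, abs_of_pos hδ0]; exact hδ1) m (m * δ * β)
  rw [← hμ] at up lo
  have hm' : (0 : ℝ) < m := Nat.cast_pos.2 hm
  refine ((lo.and up).bind (η' := 0) fun s hs => HoldsUpTo.pure ?_ 0).mono ?_ fun v hv => hv
  · constructor
    · rw [le_div_iff₀ hm']
      have : 0 < δ * (s - ((1 - δ) * μ - β * d) * m) := by nlinarith [hs.1]
      linarith [pos_of_mul_pos_right this hδ0.le]
    · rw [div_le_iff₀ hm']
      have : 0 < δ * (((1 + δ) * μ + β * d) * m - s) := by nlinarith [hs.2]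
      linarith [pos_of_mul_pos_right this hδ0.le]
  · rw [add_zero, two_mul]

end Estimates

/-! ### Greedy chains in matroids -/

section Matroid

/-- `I` is the family of independent sets of a matroid (with the symmetric exchange property,
stated for independent sets of equal size). -/
structure IsMatroid (I : Finset E → Prop) : Prop where
  empty : I ∅
  subset : ∀ {A B}, I B → A ⊆ B → I A
  augment : ∀ {A B}, I A → I B → A.card < B.card → ∃ e ∈ B, e ∉ A ∧ I (insert e A)
  exchange : ∀ {A B}, I A → I B → A.card = B.card → A ≠ B →
    ∃ i ∈ A \ B, ∃ j ∈ B \ A, I (insert j (A.erase i)) ∧ I (insert i (B.erase j))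

/-- Sets that are built from `∅` by adding elements `b`, with independent results, such that
every addition increases `Φ` by at least `h B o` for each element `o` that could be added. -/
inductive GreedyChain (I : Finset E → Prop) (Φ : Finset E → ℝ) (h : Finset E → E → ℝ) :
    Finset E → Prop
  | empty : GreedyChain I Φ h ∅
  | extend (B : Finset E) (b : E) (hB : GreedyChain I Φ h B) (hb : b ∉ B)
      (hI : I (insert b B)) (hmax : ∀ o, o ∉ B → I (insert o B) → h B o ≤ Φ (insert b B) - Φ B) :
      GreedyChain I Φ h (insert b B)

theorem GreedyChain.indep {I : Finset E → Prop} (hI : IsMatroid I) {Φ : Finset E → ℝ}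
    {h : Finset E → E → ℝ} {B : Finset E} (hB : GreedyChain I Φ h B) : I B := by
  cases hB with
  | empty => exact hI.empty
  | extend B b _ _ hI _ => exact hI

/-- Induction along the chain. Before the last addition `A` is smaller than `T`, so some `o ∈ T` was
available; its value is at most the increase just made, and monotonicity of `h` passes from `A` to
`B`. Deleting `o` from `T` restores equal sizes. -/
theorem GreedyChain.sum_le_of_card_eq {I : Finset E → Prop} (hI : IsMatroid I)
    {Φ : Finset E → ℝ} {h : Finset E → E → ℝ} (hh : ∀ S T o, S ⊆ T → I T → h T o ≤ h S o)
    {B : Finset E} (hBI : I B) {A : Finset E} (hA : GreedyChain I Φ h A) (hAB : A ⊆ B)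
    {T : Finset E} (hT : I T) (hcard : T.card = A.card) :
    ∑ o ∈ T, h B o ≤ Φ A - Φ ∅ := by
  induction hA generalizing T with
  | empty =>
    rw [Finset.card_empty, Finset.card_eq_zero] at hcard
    simp [hcard]
  | extend A b hA hb hbI hmax ih =>
    rw [Finset.card_insert_of_notMem hb] at hcard
    have hA' : A ⊆ B := (Finset.subset_insert _ _).trans hAB
    obtain ⟨o, hoT, hoA, hoI⟩ := hI.augment (hI.subset hbI (Finset.subset_insert _ _)) hT
      (by omega)
    have h1 := ih hA' (hI.subset hT (Finset.erase_subset o T))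
      (by rw [Finset.card_erase_of_mem hoT]; omega)
    have h2 := hmax o hoA hoI
    have h3 := hh A B o hA' hBI
    rw [← Finset.add_sum_erase T _ hoT]
    linarith

/-- While `T` is larger than `B`, augmentation finds an element of `T` still available at the end,
whose contribution is nonpositive; it is peeled off until the sizes agree. -/
theorem GreedyChain.sum_le {I : Finset E → Prop} (hI : IsMatroid I)
    {Φ : Finset E → ℝ} {h : Finset E → E → ℝ} (hh : ∀ S T o, S ⊆ T → I T → h T o ≤ h S o)
    {B : Finset E} (hB : GreedyChain I Φ h B) (hlast : ∀ o, o ∉ B → I (insert o B) → h B o ≤ 0)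
    {T : Finset E} (hT : I T) (hcard : B.card ≤ T.card) :
    ∑ o ∈ T, h B o ≤ Φ B - Φ ∅ := by
  obtain ⟨n, hn⟩ := Nat.exists_eq_add_of_le hcard
  induction n generalizing T with
  | zero => exact hB.sum_le_of_card_eq hI hh (hB.indep hI) subset_rfl hT hn
  | succ n ih =>
    obtain ⟨o, hoT, hoB, hoI⟩ := hI.augment (hB.indep hI) hT (by omega)
    have hc := Finset.card_erase_of_mem hoT
    have h1 := ih (hI.subset hT (Finset.erase_subset o T)) (by omega) (by omega)
    rw [← Finset.add_sum_erase T _ hoT]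
    linarith [hlast o hoB hoI]

theorem DecreasingMarginals.le_sum {f : Finset E → ℝ} (hf : DecreasingMarginals f)
    (R T : Finset E) : f (R ∪ T) - f R ≤ ∑ o ∈ T, (f (insert o R) - f R) := by
  induction T using Finset.induction_on with
  | empty => simp
  | insert a s ha ih =>
    rw [Finset.sum_insert ha, Finset.union_insert]
    have := hf R (R ∪ s) a Finset.subset_union_left
    linarith

/-- The classical chain `f T ≤ f (B ∪ T) ≤ f B + ∑ marginals at B ≤ 2 * f B`, the last step by
charging. -/
theorem DecreasingMarginals.le_of_greedyChain {I : Finset E → Prop} (hI : IsMatroid I)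
    {f : Finset E → ℝ} (hf : DecreasingMarginals f) (hmono : Monotone f) (hf0 : f ∅ = 0)
    {B : Finset E} (hB : GreedyChain I f (fun A o => f (insert o A) - f A) B)
    {T : Finset E} (hT : I T) (hcard : T.card = B.card) : f T ≤ 2 * f B := by
  have h1 := hB.sum_le_of_card_eq hI (fun S T o h _ => hf S T o h) (hB.indep hI) subset_rfl
    hT hcard
  have h2 := hf.le_sum B T
  have h3 : f T ≤ f (B ∪ T) := hmono Finset.subset_union_right
  linarith

end Matroid

/-! ### Expected marginal values at fractional points -/

section FractionalPoint

theorem fractionalPoint_nonneg (k : ℕ) (Bs : List (Finset E)) (e : E) :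
    0 ≤ fractionalPoint k Bs e := by
  unfold fractionalPoint; positivity

theorem fractionalPoint_le_one {k : ℕ} {Bs : List (Finset E)} (h : Bs.length ≤ k) (e : E) :
    fractionalPoint k Bs e ≤ 1 := by
  unfold fractionalPoint
  refine div_le_one_of_le₀ ?_ (Nat.cast_nonneg k)
  exact_mod_cast List.countP_le_length.trans h

theorem fractionalPoint_cons (k : ℕ) (B : Finset E) (Bs : List (Finset E)) (e : E) :
    fractionalPoint k (B :: Bs) e =
      fractionalPoint k Bs e + (if e ∈ B then 1 else 0) / (k : ℝ) := by
  unfold fractionalPoint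
  rw [List.countP_cons]
  by_cases h : e ∈ B <;> simp [h, add_div]

theorem fractionalPoint_cons_mono (k : ℕ) {A B : Finset E} (h : A ⊆ B) (Bs : List (Finset E))
    (e : E) : fractionalPoint k (A :: Bs) e ≤ fractionalPoint k (B :: Bs) e := by
  rw [fractionalPoint_cons, fractionalPoint_cons]
  have : (if e ∈ A then (1 : ℝ) else 0) ≤ if e ∈ B then 1 else 0 := by
    by_cases hA : e ∈ A
    · simp [hA, h hA]
    · by_cases hB : e ∈ B <;> simp [hA, hB]
  gcongr

/-- The expected marginal value of `o` at `R(x + (1 / k) 1_B)`. -/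
noncomputable def gain (f : Finset E → ℝ) (order : List E) (k : ℕ) (Bs : List (Finset E))
    (B : Finset E) (o : E) : ℝ :=
  multilinear (fractionalPoint k (B :: Bs)) order fun R => f (insert o R) - f R

theorem gain_antitone {f : Finset E → ℝ} (hf : DecreasingMarginals f) (order : List E)
    {k : ℕ} {Bs : List (Finset E)} (hk : Bs.length < k) {A B : Finset E} (h : A ⊆ B) (o : E) :
    gain f order k Bs B o ≤ gain f order k Bs A o :=
  multilinear_antitone (fractionalPoint_nonneg _ _) (fractionalPoint_le_one hk)
    (fractionalPoint_cons_mono k h Bs) fun S T hST => hf S T o hST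

theorem gain_le {f : Finset E → ℝ} (hf : DecreasingMarginals f) (hf0 : f ∅ = 0) (order : List E)
    {k : ℕ} {Bs : List (Finset E)} (hk : Bs.length < k) (B : Finset E) (o : E) :
    gain f order k Bs B o ≤ f {o} := by
  have := multilinear_mono (l := order) (fractionalPoint_nonneg k (B :: Bs))
    (fractionalPoint_le_one hk) (g := fun R => f (insert o R) - f R) (h := fun _ => f {o})
    fun R => by
      have := hf ∅ R o (Finset.empty_subset _)
      rw [insert_empty_eq, hf0] at this
      simpa using this
  rwa [multilinear_const] at this

/-- The extension is affine in the coordinate of `b`, which rises by `1 / k`. Its slope compares `R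
+ b` with `R - b`, hence dominates the gain, which compares `R + b` with `R`. -/
theorem gain_div_le {f : Finset E → ℝ} (hmono : Monotone f) {order : List E} (hnd : order.Nodup)
    {k : ℕ} {Bs : List (Finset E)} (hk : Bs.length < k) {B : Finset E} {b : E} (hb : b ∉ B)
    (hbo : b ∈ order) :
    gain f order k Bs B b / k ≤ multilinear (fractionalPoint k (insert b B :: Bs)) order f -
      multilinear (fractionalPoint k (B :: Bs)) order f := by
  set y := fractionalPoint k (B :: Bs) with hy
  set z := fractionalPoint k (insert b B :: Bs) with hz
  have hzb : z b = y b + 1 / k := by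
    rw [hy, hz, fractionalPoint_cons, fractionalPoint_cons]; simp [hb]
  have hze : ∀ e, e ≠ b → z e = y e := by
    intro e he
    rw [hy, hz, fractionalPoint_cons, fractionalPoint_cons]; simp [he]
  have e1 : multilinear z order (fun R => f (insert b R)) =
      multilinear y order (fun R => f (insert b R)) := by
    refine multilinear_congr_point fun e => ?_
    by_cases he : e = b
    · right; intro R; simp [he]
    · left; exact hze e he
  have e2 : multilinear z order (fun R => f (R.erase b)) =
      multilinear y order (fun R => f (R.erase b)) := by
    refine multilinear_congr_point fun e => ?_
    by_cases he : e = b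
    · right; intro R; congr 1; ext x
      simp only [he, Finset.mem_erase, Finset.mem_insert]; tauto
    · left; exact hze e he
  have h3 : multilinear y order (fun R => f (R.erase b)) ≤ multilinear y order f :=
    multilinear_mono (fractionalPoint_nonneg _ _) (fractionalPoint_le_one hk)
      fun R => hmono (Finset.erase_subset _ _)
  rw [multilinear_split z hnd hbo f, multilinear_split y hnd hbo f, e1, e2, hzb]
  have h4 : gain f order k Bs B b ≤ multilinear y order (fun R => f (insert b R)) -
      multilinear y order (fun R => f (R.erase b)) := by
    unfold gain
    rw [multilinear_sub, ← hy]
    linarith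
  have h5 := div_le_div_of_nonneg_right h4 (Nat.cast_nonneg (α := ℝ) k)
  refine h5.trans (le_of_eq ?_)
  ring

/-- The pointwise bound `f T - f R ≤ ∑ o ∈ T, (f (R + o) - f R)`, averaged over the random set `R`.
-/
theorem sub_le_sum_gain {f : Finset E → ℝ} (hf : DecreasingMarginals f) (hmono : Monotone f)
    (order : List E) {k : ℕ} {Bs : List (Finset E)} (hk : Bs.length < k) (B T : Finset E) :
    f T - multilinear (fractionalPoint k (B :: Bs)) order f ≤
      ∑ o ∈ T, gain f order k Bs B o := by
  unfold gain
  rw [← multilinear_sum, ← multilinear_const (fractionalPoint k (B :: Bs)) order (f T),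
    ← multilinear_sub]
  refine multilinear_mono (fractionalPoint_nonneg _ _) (fractionalPoint_le_one hk) fun R => ?_
  have := hf.le_sum R T
  have h3 : f T ≤ f (R ∪ T) := hmono Finset.subset_union_right
  linarith

end FractionalPoint

end ContinuousGreedy

namespace ContinuousGreedy

open scoped ENNReal

variable {E : Type*} [DecidableEq E]

/-! ### The decreasing-threshold procedure -/

section Threshold

variable {I : Finset E → Prop} [DecidablePred I]

omit [DecidableEq E] in
theorem le_foldr_max (f : Finset E → ℝ) (l : List E) :
    0 ≤ l.foldr (fun e d => if I {e} then max (f {e}) d else d) 0 ∧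
      ∀ e ∈ l, I {e} → f {e} ≤ l.foldr (fun e d => if I {e} then max (f {e}) d else d) 0 := by
  induction l with
  | nil => simp
  | cons a l ih =>
    simp only [List.foldr_cons]
    constructor
    · split_ifs
      · exact le_max_of_le_right ih.1
      · exact ih.1
    · intro e he hIe
      rcases List.mem_cons.1 he with rfl | he
      · rw [if_pos hIe]; exact le_max_left _ _
      · split_ifs
        · exact le_max_of_le_right (ih.2 e he hIe)
        · exact ih.2 e he hIe

omit [DecidableEq E] in
theorem maxSingleton_nonneg (f : Finset E → ℝ) (order : List E) : 0 ≤ maxSingleton I f order :=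
  (le_foldr_max f order).1

omit [DecidableEq E] in
theorem le_maxSingleton (f : Finset E → ℝ) {order : List E} {e : E} (he : e ∈ order)
    (hI : I {e}) : f {e} ≤ maxSingleton I f order :=
  (le_foldr_max f order).2 e he hI

omit [DecidableEq E] in
theorem maxSingleton_le {f : Finset E → ℝ} {order : List E} {v : ℝ} (hv : 0 ≤ v)
    (h : ∀ e, I {e} → f {e} ≤ v) : maxSingleton I f order ≤ v := by
  unfold maxSingleton
  induction order with
  | nil => exact hv
  | cons a l ih =>
    simp only [List.foldr_cons]
    split_ifs with ha
    · exact max_le (h a ha) ih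
    · exact ih

/-- The lower bound on the increase of the multilinear extension when an element is chosen
while `o` is available. -/
noncomputable def gainBound (f : Finset E → ℝ) (order : List E) (k : ℕ) (c : ℝ)
    (Bs : List (Finset E)) (B : Finset E) (o : E) : ℝ :=
  ((1 - 3 / k) * gain f order k Bs B o - 3 * c) / k

/-- The state of the threshold procedure: the set was built by nearly greedy choices, and the
available elements have expected marginal value at most `u`. -/
def ThresholdState (I : Finset E → Prop) (f : Finset E → ℝ) (order : List E) (k : ℕ) (c : ℝ)
    (Bs : List (Finset E)) (u : ℝ) (B : Finset E) : Prop :=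
  GreedyChain I (fun A => multilinear (fractionalPoint k (A :: Bs)) order f)
      (gainBound f order k c Bs) B ∧
    ∀ o, o ∉ B → I (insert o B) → gain f order k Bs B o ≤ u

/-- During the scan the old bound `u` holds for all available elements, and the new bound `u'` for
those outside the remaining list. An accepted element is nearly greedy by `u` and `hadd`; a skipped
one obeys `u'` by `hskip`. Gains only fall as `B` grows, so both bounds persist. Each scanned
element costs one `η`. -/
theorem thresholdPass_holds {f : Finset E → ℝ} (hf : DecreasingMarginals f) (hmono : Monotone f)
    {order : List E} (hnd : order.Nodup) (hIorder : ∀ A, I A → ∀ e ∈ A, e ∈ order)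
    {k : ℕ} (hk3 : 3 ≤ k) {m : ℕ} {Bs : List (Finset E)} (hk : Bs.length < k)
    (hI : IsMatroid I) {c : ℝ} {η : ℝ≥0∞} {w u u' : ℝ}
    (hacc : ∀ B e, I {e} → HoldsUpTo
      (marginalEstimate f order (fractionalPoint k (B :: Bs)) e m) η fun v =>
        (1 - 1 / (k : ℝ)) * gain f order k Bs B e - c ≤ v ∧
          v ≤ (1 + 1 / (k : ℝ)) * gain f order k Bs B e + c)
    (hadd : ∀ g, w ≤ (1 + 1 / (k : ℝ)) * g + c → (1 - 3 / k) * u - 3 * c ≤ g)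
    (hskip : ∀ g, (1 - 1 / (k : ℝ)) * g - c ≤ w → g ≤ u')
    (l : List E) (B : Finset E) (hB : ThresholdState I f order k c Bs u B)
    (hl : ∀ o, o ∉ l → o ∉ B → I (insert o B) → gain f order k Bs B o ≤ u') :
    HoldsUpTo (thresholdPass I f order k m Bs w l B) (l.length * η)
      (ThresholdState I f order k c Bs u') := by
  have hk0 : (0 : ℝ) < k := by exact_mod_cast (by omega : 0 < k)
  have h3k : (0 : ℝ) ≤ 1 - 3 / k := by
    rw [sub_nonneg, div_le_one hk0]; exact_mod_cast hk3
  induction l generalizing B with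
  | nil =>
    exact HoldsUpTo.pure ⟨hB.1, fun o ho hIo => hl o (by simp) ho hIo⟩ _
  | cons e l ih =>
    rw [thresholdPass]
    have hη : ((e :: l).length : ℝ≥0∞) * η = η + l.length * η := by
      rw [List.length_cons]; push_cast; ring
    rw [hη]
    by_cases hc : e ∉ B ∧ I (insert e B)
    · have hIe : I {e} := hI.subset hc.2 (by simp)
      refine (hacc B e hIe).bind fun v hv => ?_
      by_cases hwv : w ≤ v
      · rw [if_pos ⟨hc.1, hc.2, hwv⟩]
        have hg := hadd _ (hwv.trans hv.2)
        have mono_gain : ∀ o, gain f order k Bs (insert e B) o ≤ gain f order k Bs B o :=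
          fun o => gain_antitone hf order hk (Finset.subset_insert _ _) o
        have down : ∀ o, o ∉ insert e B → I (insert o (insert e B)) →
            o ∉ B ∧ I (insert o B) := fun o ho hIo =>
          ⟨fun h => ho (Finset.mem_insert_of_mem h), hI.subset hIo
            (Finset.insert_subset_insert _ (Finset.subset_insert _ _))⟩
        refine ih _ ⟨.extend B e hB.1 hc.1 hc.2 fun o ho hIo => ?_, fun o ho hIo => ?_⟩ ?_
        · refine le_trans ?_ (gain_div_le hmono hnd hk hc.1
            (hIorder _ hc.2 e (Finset.mem_insert_self _ _)))
          unfold gainBound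
          refine div_le_div_of_nonneg_right ?_ hk0.le
          have := mul_le_mul_of_nonneg_left (hB.2 o ho hIo) h3k
          linarith
        · obtain ⟨h1, h2⟩ := down o ho hIo
          exact (mono_gain o).trans (hB.2 o h1 h2)
        · intro o hol ho hIo
          obtain ⟨h1, h2⟩ := down o ho hIo
          refine (mono_gain o).trans (hl o ?_ h1 h2)
          rw [List.mem_cons, not_or]
          exact ⟨fun h => ho (h ▸ Finset.mem_insert_self _ _), hol⟩
      · rw [if_neg fun h => hwv h.2.2]
        refine ih _ hB fun o hol ho hIo => ?_
        by_cases hoe : o = e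
        · subst hoe
          exact hskip _ (hv.1.trans (not_le.1 hwv).le)
        · exact hl o (by simp [hoe, hol]) ho hIo
    -- An estimate is drawn even for an element that cannot be added. Its value is irrelevant, so
    -- the trivial event absorbs the budget `η`.
    · have : HoldsUpTo (marginalEstimate f order (fractionalPoint k (B :: Bs)) e m) η
          fun _ => True := by
        unfold HoldsUpTo
        simp [mean_const]
      refine this.bind fun v _ => ?_
      rw [if_neg fun h => hc ⟨h.1, h.2.1⟩]
      refine ih _ hB fun o hol ho hIo => hl o ?_ ho hIo
      rw [List.mem_cons, not_or]
      exact ⟨fun h => hc (h ▸ ⟨ho, hIo⟩), hol⟩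

/-- The bound on the marginal values of the available elements before the threshold `w`. -/
noncomputable def availableBound (k : ℕ) (c w : ℝ) : ℝ :=
  (w / (1 - 1 / (k : ℝ)) + c) / (1 - 1 / (k : ℝ))

/-- The factor `1 - 3δ` comes from `(1 - 3δ)(1 + δ) ≤ (1 - δ)²`: two divisions by `1 - δ` in
`availableBound` and the upper relative error `1 + δ` must be absorbed. -/
theorem le_gain_of_threshold_le {k : ℕ} (hk3 : 3 ≤ k) {c w g : ℝ} (hc : 0 ≤ c) (hw : 0 ≤ w)
    (h : w ≤ (1 + 1 / (k : ℝ)) * g + c) :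
    (1 - 3 / (k : ℝ)) * availableBound k c w - 3 * c ≤ g := by
  unfold availableBound
  have hk0 : (3 : ℝ) ≤ k := by exact_mod_cast hk3
  set δ := 1 / (k : ℝ) with hδ
  have h3 : 3 / (k : ℝ) = 3 * δ := by rw [hδ]; ring
  rw [h3]
  have hδ0 : 0 < δ := by positivity
  have hδ1 : δ ≤ 1 / 3 := one_div_le_one_div_of_le (by norm_num) hk0
  have h1 : (w - c) / (1 + δ) ≤ g := by
    rw [div_le_iff₀ (by linarith)]; linarith
  refine le_trans ?_ h1
  have e : (1 - 3 * δ) * ((w / (1 - δ) + c) / (1 - δ)) =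
      ((1 - 3 * δ) / (1 - δ) ^ 2) * w + ((1 - 3 * δ) / (1 - δ)) * c := by
    have : 1 - δ ≠ 0 := by linarith
    field_simp
  rw [e, sub_div w c]
  have a1 : (1 - 3 * δ) / (1 - δ) ^ 2 ≤ 1 / (1 + δ) := by
    rw [div_le_div_iff₀ (by nlinarith) (by linarith)]; nlinarith
  have a2 : (1 - 3 * δ) / (1 - δ) ≤ 1 := by
    rw [div_le_one (by linarith)]; linarith
  have a3 : c / (1 + δ) ≤ c := div_le_self hc (by linarith)
  have b1 := mul_le_mul_of_nonneg_right a1 hw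
  have b2 := mul_le_mul_of_nonneg_right a2 hc
  have : 1 / (1 + δ) * w = w / (1 + δ) := by ring
  linarith

/-- The next threshold is `(1 - 1/k) * w`; the inner division in `availableBound` recovers `w`, the
threshold at which the element was skipped. -/
theorem gain_le_of_le_threshold {k : ℕ} (hk3 : 3 ≤ k) {c w g : ℝ}
    (h : (1 - 1 / (k : ℝ)) * g - c ≤ w) :
    g ≤ availableBound k c ((1 - 1 / (k : ℝ)) * w) := by
  unfold availableBound
  have hk0 : (3 : ℝ) ≤ k := by exact_mod_cast hk3
  have hδ1 : 1 / (k : ℝ) ≤ 1 / 3 := one_div_le_one_div_of_le (by norm_num) hk0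
  rw [mul_div_cancel_left₀ _ (by linarith), le_div_iff₀ (by linarith)]
  linarith

theorem thresholdPasses_holds {f : Finset E → ℝ} (hf : DecreasingMarginals f) (hmono : Monotone f)
    {order : List E} (hnd : order.Nodup) (hIorder : ∀ A, I A → ∀ e ∈ A, e ∈ order)
    {k : ℕ} (hk3 : 3 ≤ k) {m : ℕ} {Bs : List (Finset E)} (hk : Bs.length < k)
    (hI : IsMatroid I) {c d : ℝ} (hc : 0 ≤ c) (hd : 0 ≤ d) {η : ℝ≥0∞}
    (hacc : ∀ B e, I {e} → HoldsUpTo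
      (marginalEstimate f order (fractionalPoint k (B :: Bs)) e m) η fun v =>
        (1 - 1 / (k : ℝ)) * gain f order k Bs B e - c ≤ v ∧
          v ≤ (1 + 1 / (k : ℝ)) * gain f order k Bs B e + c)
    (n a : ℕ) (B : Finset E)
    (hB : ThresholdState I f order k c Bs
      (availableBound k c ((1 - 1 / (k : ℝ)) ^ a * d)) B) :
    HoldsUpTo (thresholdPasses I f order k m Bs
        ((List.range' a n).map fun s => (1 - 1 / (k : ℝ)) ^ s * d) B) (n * (order.length * η))
      (ThresholdState I f order k c Bs
        (availableBound k c ((1 - 1 / (k : ℝ)) ^ (a + n) * d))) := by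
  have hk0 : (3 : ℝ) ≤ k := by exact_mod_cast hk3
  have hδ1 : 1 / (k : ℝ) ≤ 1 / 3 := one_div_le_one_div_of_le (by norm_num) hk0
  induction n generalizing a B with
  | zero => exact HoldsUpTo.pure hB _
  | succ n ih =>
    rw [List.range'_succ, List.map_cons, thresholdPasses]
    have hη : ((n + 1 : ℕ) : ℝ≥0∞) * (order.length * η) =
        order.length * η + n * (order.length * η) := by push_cast; ring
    rw [hη]
    refine (thresholdPass_holds hf hmono hnd hIorder hk3 hk hI
      (u' := availableBound k c ((1 - 1 / (k : ℝ)) ^ (a + 1) * d)) hacc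
      (fun g hg => le_gain_of_threshold_le hk3 hc ?_ hg) (fun g hg => ?_)
      order B hB fun o ho _ hIo => ?_).bind fun B' hB' => ?_
    · exact mul_nonneg (pow_nonneg (by linarith) _) hd
    · rw [pow_succ', mul_assoc]
      exact gain_le_of_le_threshold hk3 hg
    -- Each pass starts with the full enumeration, so no available element lies outside the list.
    · exact absurd (hIorder _ hIo o (Finset.mem_insert_self _ _)) ho
    · have := ih (a + 1) B' hB'
      rwa [show a + 1 + n = a + (n + 1) by omega] at this

/-- The number of thresholds. -/
noncomputable def thresholdCount (r k : ℕ) : ℕ :=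
  sInf {s : ℕ | (1 - 1 / (k : ℝ)) ^ s < 1 / (k : ℝ) / (r : ℝ)}

/-- Since `(1 - 1/k)^k ≤ 1/e`, this exponent gives at most `exp (-k r) < 1 / (k r)`. The infimum in
`thresholdCount` is therefore attained, and a crude polynomial bound on it suffices for the union
bound. -/
theorem pow_lt_of_threshold {r k : ℕ} (hr : 0 < r) (hk : 0 < k) :
    (1 - 1 / (k : ℝ)) ^ (k * (k * r)) < 1 / (k : ℝ) / (r : ℝ) := by
  have hk0 : (1 : ℝ) ≤ k := by exact_mod_cast hk
  have hr0 : (1 : ℝ) ≤ r := by exact_mod_cast hr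
  have h1 : 1 - 1 / (k : ℝ) ≤ Real.exp (-(1 / k)) := by
    have := Real.add_one_le_exp (-(1 / (k : ℝ))); linarith
  have h0 : 0 ≤ 1 - 1 / (k : ℝ) := by
    rw [sub_nonneg, div_le_one (by linarith)]; exact hk0
  calc _ ≤ Real.exp (-(1 / k)) ^ (k * (k * r)) := pow_le_pow_left₀ h0 h1 _
    _ = Real.exp (-(k * r)) := by
        rw [← Real.exp_nat_mul]; congr 1; push_cast; field_simp
    _ < (k * r : ℝ)⁻¹ := by
        rw [Real.exp_neg]
        refine inv_strictAnti₀ (by positivity) ?_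
        have := Real.add_one_le_exp (k * r : ℝ); linarith
    _ = _ := by rw [div_div, one_div]

theorem thresholdCount_le {r k : ℕ} (hr : 0 < r) (hk : 0 < k) :
    thresholdCount r k ≤ k * (k * r) :=
  Nat.sInf_le (pow_lt_of_threshold hr hk)

theorem pow_thresholdCount_lt {r k : ℕ} (hr : 0 < r) (hk : 0 < k) :
    (1 - 1 / (k : ℝ)) ^ thresholdCount r k < 1 / (k : ℝ) / (r : ℝ) :=
  Nat.sInf_mem (s := {s : ℕ | (1 - 1 / (k : ℝ)) ^ s < 1 / (k : ℝ) / (r : ℝ)})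
    ⟨_, pow_lt_of_threshold hr hk⟩

/-- The first unused threshold lies below `c = δ d / r`, so the remaining gains are of the order of
the additive error. The bound `2c ≤ 3c(1 - δ)`, valid for `δ ≤ 1/3`, gives the constant.
Consequently `gainBound` is nonpositive for elements still available at the end. -/
theorem availableBound_final {r k : ℕ} (hr : 0 < r) (hk3 : 3 ≤ k) {d : ℝ} (hd : 0 ≤ d) :
    (1 - 3 / (k : ℝ)) * availableBound k (1 / k / r * d)
      ((1 - 1 / (k : ℝ)) ^ thresholdCount r k * d) ≤ 3 * (1 / k / r * d) := by
  have hk0 : (3 : ℝ) ≤ k := by exact_mod_cast hk3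
  have hw : (1 - 1 / (k : ℝ)) ^ thresholdCount r k * d ≤ 1 / k / r * d :=
    mul_le_mul_of_nonneg_right (pow_thresholdCount_lt hr (by omega)).le hd
  set w := (1 - 1 / (k : ℝ)) ^ thresholdCount r k * d
  set c := 1 / (k : ℝ) / r * d with hc
  have hc0 : 0 ≤ c := by positivity
  unfold availableBound
  set δ := 1 / (k : ℝ) with hδ
  have h3 : 3 / (k : ℝ) = 3 * δ := by rw [hδ]; ring
  have hδ0 : 0 < δ := by positivity
  have hδ1 : δ ≤ 1 / 3 := one_div_le_one_div_of_le (by norm_num) hk0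
  rw [h3, ← mul_div_assoc, div_le_iff₀ (by linarith)]
  have : w / (1 - δ) ≤ c / (1 - δ) := div_le_div_of_nonneg_right hw (by linarith)
  have h4 : (1 - 3 * δ) * (w / (1 - δ)) ≤ c := by
    refine (mul_le_mul_of_nonneg_left this (by linarith)).trans ?_
    rw [← mul_div_assoc, div_le_iff₀ (by linarith)]
    nlinarith
  nlinarith

end Threshold

end ContinuousGreedy

namespace ContinuousGreedy

open scoped ENNReal

variable {E : Type*} [DecidableEq E] {I : Finset E → Prop} [DecidablePred I]

/-! ### Progress of the continuous greedy process -/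

section ContinuousProcess

theorem mem_support_thresholdPass {f : Finset E → ℝ} {order : List E} {k m : ℕ}
    {Bs : List (Finset E)} {w : ℝ} {l : List E} {B A : Finset E} (hB : I B)
    (hA : A ∈ (thresholdPass I f order k m Bs w l B).support) : I A := by
  induction l generalizing B with
  | nil =>
    rw [thresholdPass, PMF.mem_support_pure_iff] at hA
    exact hA ▸ hB
  | cons e l ih =>
    rw [thresholdPass, PMF.mem_support_bind_iff] at hA
    obtain ⟨v, _, hA⟩ := hA
    refine ih ?_ hA
    split_ifs with h
    · exact h.2.1
    · exact hB

theorem mem_support_thresholdPasses {f : Finset E → ℝ} {order : List E} {k m : ℕ}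
    {Bs : List (Finset E)} {ws : List ℝ} {B A : Finset E} (hB : I B)
    (hA : A ∈ (thresholdPasses I f order k m Bs ws B).support) : I A := by
  induction ws generalizing B with
  | nil =>
    rw [thresholdPasses, PMF.mem_support_pure_iff] at hA
    exact hA ▸ hB
  | cons w ws ih =>
    rw [thresholdPasses, PMF.mem_support_bind_iff] at hA
    obtain ⟨B', hB', hA⟩ := hA
    exact ih (mem_support_thresholdPass hB hB') hA

theorem mem_support_steps (hI : I ∅) {f : Finset E → ℝ} {order : List E} {r k m t : ℕ}
    {Bs : List (Finset E)} (h : Bs ∈ (steps I f order r k m t).support) :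
    Bs.length = t ∧ ∀ B ∈ Bs, I B := by
  induction t generalizing Bs with
  | zero =>
    rw [steps, PMF.mem_support_pure_iff] at h
    simp [h]
  | succ t ih =>
    rw [steps, PMF.mem_support_bind_iff] at h
    obtain ⟨Cs, hCs, h⟩ := h
    rw [PMF.mem_support_bind_iff] at h
    obtain ⟨B, hB, h⟩ := h
    rw [PMF.mem_support_pure_iff] at h
    subst h
    obtain ⟨h1, h2⟩ := ih hCs
    refine ⟨by simp [h1], fun A hA => ?_⟩
    rcases List.mem_cons.1 hA with rfl | hA
    · exact mem_support_thresholdPasses hI hB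
    · exact h2 A hA

/-- The failure probability of a single estimate. -/
noncomputable def estimateFailure (r k m : ℕ) : ℝ≥0∞ :=
  2 * ENNReal.ofReal (Real.exp (-(m * (1 / (k : ℝ)) * (1 / (k : ℝ) / r))))

/-- Charging the `r` elements of `T` to the choices made in the step bounds the increase of the
extension below by the sum of their gain bounds. The `r` additive errors `3 δ d / r` add up to `3 δ
d ≤ 3 δ f T`, and the step size contributes one more factor `δ`. -/
theorem decreasingThreshold_holds {f : Finset E → ℝ} (hf : DecreasingMarginals f)
    (hmono : Monotone f) (hf0 : f ∅ = 0) {order : List E} (hnd : order.Nodup)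
    (hIorder : ∀ A, I A → ∀ e ∈ A, e ∈ order) {r k m : ℕ} (hr : 0 < r) (hk3 : 3 ≤ k)
    (hm : 0 < m) {Bs : List (Finset E)} (hk : Bs.length < k) (hI : IsMatroid I)
    (hrank : ∀ A, I A → A.card ≤ r) {T : Finset E} (hT : I T) (hTr : T.card = r)
    (hd : 0 < maxSingleton I f order) (hdT : maxSingleton I f order ≤ f T) :
    HoldsUpTo (decreasingThreshold I f order r k m Bs)
      (thresholdCount r k * (order.length * estimateFailure r k m)) fun B =>
        (1 + (1 - 3 / (k : ℝ)) / k) *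
            (f T - multilinear (fractionalPoint k (B :: Bs)) order f) ≤
          f T - multilinear (fractionalPoint k Bs) order f + 3 / k / k * f T := by
  have hk0 : (3 : ℝ) ≤ k := by exact_mod_cast hk3
  have hδ1 : 1 / (k : ℝ) ≤ 1 / 3 := one_div_le_one_div_of_le (by norm_num) hk0
  have hr0 : (0 : ℝ) < r := Nat.cast_pos.2 hr
  set d := maxSingleton I f order with hd_def
  set c := 1 / (k : ℝ) / r * d with hc
  have hc0 : 0 ≤ c := by positivity
  have h3k : 0 ≤ 1 - 3 / (k : ℝ) := by
    rw [sub_nonneg, div_le_one (by linarith)]; exact hk0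
  have single : ∀ e, I {e} → f {e} ≤ d := fun e he =>
    le_maxSingleton f (hIorder _ he e (Finset.mem_singleton_self e)) he
  have hacc : ∀ B e, I {e} → HoldsUpTo
      (marginalEstimate f order (fractionalPoint k (B :: Bs)) e m) (estimateFailure r k m) fun v =>
        (1 - 1 / (k : ℝ)) * gain f order k Bs B e - c ≤ v ∧
          v ≤ (1 + 1 / (k : ℝ)) * gain f order k Bs B e + c := by
    intro B e he
    refine marginalEstimate_accurate (f := f) (order := order) (e := e) (δ := 1 / (k : ℝ))
      (fractionalPoint_nonneg k (B :: Bs))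
      (fractionalPoint_le_one hk) hd (fun R => sub_nonneg.2 (hmono (Finset.subset_insert _ _))) (fun R => ?_)
      (by positivity) (by linarith) hm _
    have := hf ∅ R e (Finset.empty_subset _)
    rw [insert_empty_eq, hf0] at this
    linarith [single e he]
  have start : ThresholdState I f order k c Bs
      (availableBound k c ((1 - 1 / (k : ℝ)) ^ 0 * d)) ∅ := by
    refine ⟨.empty, fun o _ hIo => ?_⟩
    refine (gain_le hf hf0 order hk _ _).trans ((single o (by simpa using hIo)).trans ?_)
    unfold availableBound
    have h1 : d ≤ d / (1 - 1 / (k : ℝ)) := by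
      rw [le_div_iff₀ (by linarith)]
      have : 0 < 1 / (k : ℝ) := by positivity
      nlinarith
    rw [pow_zero, one_mul, le_div_iff₀ (by linarith)]
    have : 0 < 1 / (k : ℝ) := by positivity
    nlinarith
  have key := thresholdPasses_holds hf hmono hnd hIorder hk3 hk hI hc0 hd.le hacc
    (thresholdCount r k) 0 ∅ start
  rw [← List.range_eq_range', zero_add] at key
  refine key.mono le_rfl fun B hB => ?_
  have hkpos : (0 : ℝ) < k := by linarith
  -- The gain bounds are taken at the final `B`, the point after the step. Hence the recursion is
  -- implicit and the new gap carries the factor larger than one.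
  have h1 := hB.1.sum_le hI (T := T) (fun S A o hSA _ => ?_) (fun o ho hIo => ?_) hT ?_
  · have h2 := sub_le_sum_gain hf hmono order hk B T
    have e1 : ∑ o ∈ T, gainBound f order k c Bs B o =
        ((1 - 3 / (k : ℝ)) * ∑ o ∈ T, gain f order k Bs B o - 3 * (1 / k * d)) / k := by
      unfold gainBound
      rw [← Finset.sum_div, Finset.sum_sub_distrib, ← Finset.mul_sum, Finset.sum_const,
        nsmul_eq_mul, hTr, hc]
      congr 2
      field_simp
    have e2 : multilinear (fractionalPoint k (∅ :: Bs)) order f =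
        multilinear (fractionalPoint k Bs) order f := by
      refine multilinear_congr_point fun e => Or.inl ?_
      rw [fractionalPoint_cons]; simp
    rw [e1, e2] at h1
    have h3 := mul_le_mul_of_nonneg_left h2 h3k
    have h4 : 3 * (1 / (k : ℝ) * d) ≤ 3 / k * f T := by
      rw [← mul_assoc, mul_one_div]
      exact mul_le_mul_of_nonneg_left hdT (by positivity)
    have h5 := div_le_div_of_nonneg_right (sub_le_sub h3 h4) hkpos.le
    have e3 : ((1 - 3 / (k : ℝ)) * (f T - multilinear (fractionalPoint k (B :: Bs)) order f) -
        3 / k * f T) / k = (1 - 3 / (k : ℝ)) / k *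
          (f T - multilinear (fractionalPoint k (B :: Bs)) order f) - 3 / k / k * f T := by ring
    rw [e3] at h5
    linarith
  · unfold gainBound
    have := mul_le_mul_of_nonneg_left (gain_antitone hf order hk hSA o) h3k
    gcongr
  · unfold gainBound
    refine div_nonpos_of_nonpos_of_nonneg ?_ hkpos.le
    have h2 := mul_le_mul_of_nonneg_left (hB.2 o ho hIo) h3k
    have h3 := availableBound_final (d := d) hr hk3 hd.le
    rw [← hc] at h3
    linarith
  · rw [hTr]; exact hrank B (hB.1.indep hI)

/-- Iterates the one-step inequality. Dividing by `1 + (1 - 3δ)δ ≥ 1` never enlarges the earlier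
additive errors, so they grow at most linearly in `t`. -/
theorem steps_holds {f : Finset E → ℝ} (hf : DecreasingMarginals f)
    (hmono : Monotone f) (hf0 : f ∅ = 0) {order : List E} (hnd : order.Nodup)
    (hIorder : ∀ A, I A → ∀ e ∈ A, e ∈ order) {r k m : ℕ} (hr : 0 < r) (hk3 : 3 ≤ k)
    (hm : 0 < m) (hI : IsMatroid I)
    (hrank : ∀ A, I A → A.card ≤ r) {T : Finset E} (hT : I T) (hTr : T.card = r)
    (hd : 0 < maxSingleton I f order) (hdT : maxSingleton I f order ≤ f T) {t : ℕ} (ht : t ≤ k) :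
    HoldsUpTo (steps I f order r k m t)
      (t * (thresholdCount r k * (order.length * estimateFailure r k m))) fun Bs =>
        Bs.length = t ∧ f T - multilinear (fractionalPoint k Bs) order f ≤
          (1 / (1 + (1 - 3 / (k : ℝ)) / k)) ^ t * f T + t * (3 / k / k * f T) := by
  have hk0 : (3 : ℝ) ≤ k := by exact_mod_cast hk3
  have h3k : 0 ≤ 1 - 3 / (k : ℝ) := by
    rw [sub_nonneg, div_le_one (by linarith)]; exact hk0
  have hfT : 0 ≤ f T := hd.le.trans hdT
  set F := fun Bs => multilinear (fractionalPoint k Bs) order f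
  induction t with
  | zero =>
    refine HoldsUpTo.pure ⟨rfl, ?_⟩ _
    rw [multilinear_indicator (A := ∅) (Finset.empty_subset _) hnd
      (fun e => by simp [fractionalPoint])]
    simp [hf0]
  | succ t ih =>
    rw [steps]
    have hη : ((t + 1 : ℕ) : ℝ≥0∞) *
        (thresholdCount r k * (order.length * estimateFailure r k m)) =
        t * (thresholdCount r k * (order.length * estimateFailure r k m)) +
          (thresholdCount r k * (order.length * estimateFailure r k m) + 0) := by
      push_cast; ring
    rw [hη]
    refine (ih (by omega)).bind fun Bs hBs => ?_
    refine (decreasingThreshold_holds hf hmono hf0 hnd hIorder hr hk3 hm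
      (hBs.1.trans_lt (by omega)) hI hrank hT hTr hd hdT).bind fun B hB =>
        HoldsUpTo.pure ⟨by simp [hBs.1], ?_⟩ _
    set x := (1 - 3 / (k : ℝ)) / k with hx
    have hx0 : 0 ≤ x := div_nonneg h3k (by linarith)
    have hc : 0 ≤ 3 / (k : ℝ) / k * f T := by positivity
    have h1 := hBs.2
    set a := 3 / (k : ℝ) / k * f T
    have h2 := hB.trans (add_le_add_left h1 a)
    rw [mul_comm, ← le_div_iff₀ (by linarith)] at h2
    refine h2.trans ?_
    rw [add_assoc, add_div, pow_succ]
    refine add_le_add (le_of_eq (by ring)) ?_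
    refine (div_le_self (by positivity) (by linarith)).trans (le_of_eq ?_)
    push_cast; ring

end ContinuousProcess

/-! ### Extension to bases and swap rounding -/

section Rounding

/-- One scan suffices: an element rejected for a smaller set stays rejected, because independence is
hereditary. -/
theorem foldl_insert_spec (hI : IsMatroid I) (l : List E) {B : Finset E} (hB : I B) :
    B ⊆ l.foldl (fun B e => if I (insert e B) then insert e B else B) B ∧
      I (l.foldl (fun B e => if I (insert e B) then insert e B else B) B) ∧
      ∀ e ∈ l, I (insert e (l.foldl (fun B e => if I (insert e B) then insert e B else B) B)) →
        e ∈ l.foldl (fun B e => if I (insert e B) then insert e B else B) B := by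
  induction l generalizing B with
  | nil => simpa using hB
  | cons a l ih =>
    simp only [List.foldl_cons]
    by_cases ha : I (insert a B)
    · simp only [if_pos ha]
      obtain ⟨h1, h2, h3⟩ := ih ha
      refine ⟨(Finset.subset_insert _ _).trans h1, h2, fun e he hIe => ?_⟩
      rcases List.mem_cons.1 he with rfl | he
      · exact h1 (Finset.mem_insert_self _ _)
      · exact h3 e he hIe
    · simp only [if_neg ha]
      obtain ⟨h1, h2, h3⟩ := ih hB
      refine ⟨h1, h2, fun e he hIe => ?_⟩
      rcases List.mem_cons.1 he with rfl | he
      · exact absurd (hI.subset hIe (Finset.insert_subset_insert _ h1)) ha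
      · exact h3 e he hIe

theorem subset_extendToBase (hI : IsMatroid I) (order : List E) {B : Finset E} (hB : I B) :
    B ⊆ extendToBase I order B :=
  (foldl_insert_spec hI order hB).1

theorem indep_extendToBase (hI : IsMatroid I) (order : List E) {B : Finset E} (hB : I B) :
    I (extendToBase I order B) :=
  (foldl_insert_spec hI order hB).2.1

theorem card_extendToBase (hI : IsMatroid I) {order : List E}
    (hIorder : ∀ A, I A → ∀ e ∈ A, e ∈ order) {r : ℕ} (hrank : ∀ A, I A → A.card ≤ r)
    {T : Finset E} (hT : I T) (hTr : T.card = r) {B : Finset E} (hB : I B) :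
    (extendToBase I order B).card = r := by
  have h := indep_extendToBase hI order hB
  refine (hrank _ h).antisymm (not_lt.1 fun hlt => ?_)
  obtain ⟨e, heT, he, hIe⟩ := hI.augment h hT (hTr ▸ hlt)
  exact he ((foldl_insert_spec hI order hB).2.2 e (hIorder _ hT e heT) hIe)

theorem exchangePair_eq_none (hI : IsMatroid I) {order : List E}
    (hIorder : ∀ A, I A → ∀ e ∈ A, e ∈ order) {B₁ B₂ : Finset E} (h₁ : I B₁) (h₂ : I B₂)
    (hcard : B₁.card = B₂.card) (h : exchangePair I order B₁ B₂ = none) : B₁ = B₂ := by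
  by_contra hne
  obtain ⟨i, hi, j, hj, hij, hji⟩ := hI.exchange h₁ h₂ hcard hne
  rw [exchangePair, List.find?_eq_none] at h
  refine h (i, j) ?_ (by simpa using ⟨by simpa using hi, by simpa using hj, hij, hji⟩)
  exact List.pair_mem_product.2 ⟨hIorder _ h₁ i (Finset.mem_sdiff.1 hi).1, hIorder _ h₂ j (Finset.mem_sdiff.1 hj).1⟩

theorem exchangePair_eq_some {order : List E} {B₁ B₂ : Finset E} {i j : E}
    (h : exchangePair I order B₁ B₂ = some (i, j)) :
    i ∈ B₁ \ B₂ ∧ j ∈ B₂ \ B₁ ∧ I (insert j (B₁.erase i)) ∧ I (insert i (B₂.erase j)) := by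
  have := List.find?_some h
  exact of_decide_eq_true this

theorem card_insert_erase {B : Finset E} {i j : E} (hi : i ∈ B) (hj : j ∉ B) :
    (insert j (B.erase i)).card = B.card := by
  rw [Finset.card_insert_of_notMem fun h => hj (Finset.mem_of_mem_erase h),
    Finset.card_erase_add_one hi]

theorem mem_support_mergeBases {order : List E} {β₁ β₂ : ℝ} {r s : ℕ} {B₁ B₂ A : Finset E}
    (h₁ : I B₁ ∧ B₁.card = r) (h₂ : I B₂ ∧ B₂.card = r)
    (hA : A ∈ (mergeBases I order β₁ β₂ s B₁ B₂).support) : I A ∧ A.card = r := by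
  induction s generalizing B₁ B₂ with
  | zero =>
    rw [mergeBases, PMF.mem_support_pure_iff] at hA
    exact hA ▸ h₁
  | succ s ih =>
    rw [mergeBases] at hA
    split at hA
    · rw [PMF.mem_support_pure_iff] at hA
      exact hA ▸ h₁
    · rename_i i j hp
      obtain ⟨hi, hj, hij, hji⟩ := exchangePair_eq_some hp
      rw [Finset.mem_sdiff] at hi hj
      rw [PMF.mem_support_bind_iff] at hA
      obtain ⟨b, _, hA⟩ := hA
      split_ifs at hA
      · exact ih h₁ ⟨hji, by rw [card_insert_erase hj.1 hi.2, h₂.2]⟩ hA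
      · exact ih ⟨hij, by rw [card_insert_erase hi.1 hj.2, h₁.2]⟩ h₂ hA

theorem mem_support_swapRoundFrom {order : List E} {r l : ℕ} {C A : Finset E}
    {Bs : List (Finset E)} (hC : I C ∧ C.card = r) (hBs : ∀ B ∈ Bs, I B ∧ B.card = r)
    (hA : A ∈ (swapRoundFrom I order l C Bs).support) : I A ∧ A.card = r := by
  induction Bs generalizing l C with
  | nil =>
    rw [swapRoundFrom, PMF.mem_support_pure_iff] at hA
    exact hA ▸ hC
  | cons B Bs ih =>
    rw [swapRoundFrom, PMF.mem_support_bind_iff] at hA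
    obtain ⟨C', hC', hA⟩ := hA
    exact ih (mem_support_mergeBases hC (hBs B (by simp)) hC')
      (fun D hD => hBs D (by simp [hD])) hA

/-- The point `(β₁ 1_{B₁} + β₂ 1_{B₂} + c) / k`. -/
noncomputable def mergePoint (k : ℕ) (c : E → ℝ) (β₁ β₂ : ℝ) (B₁ B₂ : Finset E) (e : E) : ℝ :=
  (β₁ * (if e ∈ B₁ then 1 else 0) + β₂ * (if e ∈ B₂ then 1 else 0) + c e) / k

/-- Every exchange preserves the expected point, so convexity along `1_i - 1_j` gives a Jensen
inequality. In either outcome `i` leaves `B₁ \ B₂` and nothing enters it, so `s` exchanges are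
enough. -/
theorem le_mean_mergeBases (hI : IsMatroid I) {f : Finset E → ℝ} (hf : DecreasingMarginals f)
    {order : List E} (hnd : order.Nodup) (hIorder : ∀ A, I A → ∀ e ∈ A, e ∈ order)
    {k : ℕ} {c : E → ℝ} {β₁ β₂ : ℝ} (hβ₁ : 0 < β₁) (hβ₂ : 0 < β₂) (hc0 : ∀ e, 0 ≤ c e)
    (hc1 : ∀ e, β₁ + β₂ + c e ≤ k) {s : ℕ} {B₁ B₂ : Finset E} (h₁ : I B₁) (h₂ : I B₂)
    (hcard : B₁.card = B₂.card) (hs : (B₁ \ B₂).card ≤ s) :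
    ENNReal.ofReal (multilinear (mergePoint k c β₁ β₂ B₁ B₂) order f) ≤
      mean (mergeBases I order β₁ β₂ s B₁ B₂) fun C =>
        ENNReal.ofReal (multilinear (mergePoint k c β₁ β₂ C C) order f) := by
  induction s generalizing B₁ B₂ with
  | zero =>
    have h : B₁ ⊆ B₂ := by
      rwa [Nat.le_zero, Finset.card_eq_zero, Finset.sdiff_eq_empty_iff_subset] at hs
    have := Finset.eq_of_subset_of_card_le h hcard.ge
    subst this
    rw [mergeBases, mean_pure]
  | succ s ih =>
    rw [mergeBases]
    split
    · rename_i hp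
      have := exchangePair_eq_none hI hIorder h₁ h₂ hcard hp
      subst this
      rw [mean_pure]
    · rename_i i j hp
      obtain ⟨hi, hj, hij, hji⟩ := exchangePair_eq_some hp
      rw [Finset.mem_sdiff] at hi hj
      have hne : i ≠ j := fun h => hj.2 (h ▸ hi.1)
      have hsum : 0 < β₁ + β₂ := by linarith
      have hp0 : 0 ≤ β₁ / (β₁ + β₂) := by positivity
      have hp1 : β₁ / (β₁ + β₂) ≤ 1 := (div_le_one hsum).2 (by linarith)
      rw [mean_bind, mean_coin hp0 hp1]
      simp only [if_true, Bool.false_eq_true, if_false]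
      have ih₁ := ih (B₁ := B₁) (B₂ := insert i (B₂.erase j)) h₁ hji
        (by rw [card_insert_erase hj.1 hi.2, hcard]) (by
          have : B₁ \ insert i (B₂.erase j) ⊆ (B₁ \ B₂).erase i := by
            intro x; simp only [Finset.mem_sdiff, Finset.mem_insert, Finset.mem_erase]
            rintro ⟨hx, hx'⟩
            push Not at hx'
            exact ⟨hx'.1, hx, fun h => hx'.2 (fun h' => hj.2 (h' ▸ hx)) h⟩
          have h' := Finset.card_le_card this
          rw [Finset.card_erase_of_mem (Finset.mem_sdiff.2 hi)] at h'
          omega)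
      have ih₂ := ih (B₁ := insert j (B₁.erase i)) (B₂ := B₂) hij h₂
        (by rw [card_insert_erase hi.1 hj.2, hcard]) (by
          have : insert j (B₁.erase i) \ B₂ ⊆ (B₁ \ B₂).erase i := by
            intro x; simp only [Finset.mem_sdiff, Finset.mem_insert, Finset.mem_erase]
            rintro ⟨rfl | hx, hx'⟩
            · exact absurd hj.1 hx'
            · exact ⟨hx.1, hx.2, hx'⟩
          have h' := Finset.card_le_card this
          rw [Finset.card_erase_of_mem (Finset.mem_sdiff.2 hi)] at h'
          omega)
      refine le_trans ?_ (add_le_add (mul_le_mul_right ih₁ _) (mul_le_mul_right ih₂ _))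
      rw [← ENNReal.ofReal_mul hp0, ← ENNReal.ofReal_mul (sub_nonneg.2 hp1)]
      refine le_trans (ENNReal.ofReal_le_ofReal ?_) ENNReal.ofReal_add_le
      have ind0 : ∀ (B : Finset E) e, (0 : ℝ) ≤ if e ∈ B then 1 else 0 := fun B e => by
        split_ifs <;> norm_num
      have ind1 : ∀ (B : Finset E) e, (if e ∈ B then (1 : ℝ) else 0) ≤ 1 := fun B e => by
        split_ifs <;> norm_num
      -- Changing `B₂` moves the point by `β₂ / k` and happens with probability proportional to
      -- `β₁`; changing `B₁` moves it back by `β₁ / k` with probability proportional to `β₂`.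
      refine le_multilinear_swap hf hnd (hIorder _ h₁ i hi.1) (hIorder _ h₂ j hj.1) hne
        (s := β₂ / k) (t := β₁ / k) (fun e => ?_) (fun e => ?_) hp0 (sub_nonneg.2 hp1) (by ring)
        ?_ ?_ ?_ ?_ ?_ ?_ ?_
      · unfold mergePoint
        have := ind0 B₁ e
        have := ind0 B₂ e
        have := hc0 e
        positivity
      · unfold mergePoint
        refine div_le_one_of_le₀ (le_trans ?_ (hc1 e)) (Nat.cast_nonneg k)
        have := mul_le_mul_of_nonneg_left (ind1 B₁ e) hβ₁.le
        have := mul_le_mul_of_nonneg_left (ind1 B₂ e) hβ₂.le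
        linarith
      · rcases Nat.eq_zero_or_pos k with rfl | hk
        · simp
        · have : (0 : ℝ) < k := Nat.cast_pos.2 hk
          field_simp
          ring
      all_goals try intro e hei hej
      all_goals unfold mergePoint
      · simp [hi.1, hi.2]; ring
      · simp [hj.1, hj.2, hne.symm]; ring
      · simp [hei, hej]
      · simp [hi.1, hi.2, hne]; ring
      · simp [hj.1, hj.2]; ring
      · simp [hei, hej]

/-- `C` stands for `l` merged bases and so has weight `l`; the bases still to come form the constant
part `c` of the merge. When none remain, `l = k` and the point is the indicator of `C`, where the
extension equals `f`. -/
theorem le_mean_swapRoundFrom (hI : IsMatroid I) {f : Finset E → ℝ} (hf : DecreasingMarginals f)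
    {order : List E} (hnd : order.Nodup) (hIorder : ∀ A, I A → ∀ e ∈ A, e ∈ order)
    {k r l : ℕ} (hl : 0 < l) {C : Finset E} {Bs : List (Finset E)} (hk : l + Bs.length = k)
    (hC : I C ∧ C.card = r) (hBs : ∀ B ∈ Bs, I B ∧ B.card = r) :
    ENNReal.ofReal (multilinear (fun e => ((l : ℝ) * (if e ∈ C then 1 else 0) +
        (Bs.countP fun B => decide (e ∈ B) : ℕ)) / (k : ℝ)) order f) ≤
      mean (swapRoundFrom I order l C Bs) fun A => ENNReal.ofReal (f A) := by
  induction Bs generalizing l C with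
  | nil =>
    rw [swapRoundFrom, mean_pure]
    have hk' : l = k := by simpa using hk
    subst hk'
    have : (l : ℝ) ≠ 0 := by exact_mod_cast hl.ne'
    rw [multilinear_indicator (A := C) (fun e he => List.mem_toFinset.2 (hIorder _ hC.1 e he)) hnd]
    intro e
    split_ifs <;> simp [this]
  | cons B Bs ih =>
    rw [swapRoundFrom, mean_bind]
    rw [List.length_cons] at hk
    have hB := hBs B (by simp)
    have h1 := le_mean_mergeBases hI hf hnd hIorder (k := k)
      (c := fun e => (Bs.countP fun B => decide (e ∈ B) : ℕ)) (β₁ := l) (β₂ := 1)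
      (Nat.cast_pos.2 hl) one_pos (fun e => Nat.cast_nonneg _) (fun e => ?_) hC.1 hB.1
      (hC.2.trans hB.2.symm) le_rfl
    · refine le_trans (le_of_eq ?_) (h1.trans (mean_le_mean_of_support _ fun C' hC' => ?_))
      · congr 2
        funext e
        unfold mergePoint
        rw [List.countP_cons]
        by_cases he : e ∈ B <;> simp [he]; ring
      · refine le_trans (le_of_eq ?_) (ih (Nat.succ_pos l) (by omega)
          (mem_support_mergeBases hC hB hC') fun D hD => hBs D (by simp [hD]))
        congr 2
        funext e
        unfold mergePoint
        push_cast
        ring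
    · have : Bs.countP (fun B => decide (e ∈ B)) ≤ Bs.length := List.countP_le_length
      have : l + 1 + Bs.countP (fun B => decide (e ∈ B)) ≤ k := by omega
      exact_mod_cast this

theorem countP_mem_le_map (hI : IsMatroid I) (order : List E) {Bs : List (Finset E)}
    (hBs : ∀ B ∈ Bs, I B) (e : E) :
    (Bs.countP fun B => decide (e ∈ B)) ≤
      (Bs.map (extendToBase I order)).countP fun B => decide (e ∈ B) := by
  rw [List.countP_map]
  refine List.countP_mono_left fun B hB h => ?_
  simpa using subset_extendToBase hI order (hBs B hB) (of_decide_eq_true h)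

/-- Extending the sets to bases only raises coordinates, which does not decrease the extension of a
monotone function. -/
theorem le_mean_swapRound (hI : IsMatroid I) {f : Finset E → ℝ} (hf : DecreasingMarginals f)
    (hmono : Monotone f) {order : List E} (hnd : order.Nodup)
    (hIorder : ∀ A, I A → ∀ e ∈ A, e ∈ order) {k r : ℕ} (hk : 0 < k)
    (hrank : ∀ A, I A → A.card ≤ r) {T : Finset E} (hT : I T) (hTr : T.card = r)
    {Bs : List (Finset E)} (hlen : Bs.length = k) (hBs : ∀ B ∈ Bs, I B) :
    ENNReal.ofReal (multilinear (fractionalPoint k Bs) order f) ≤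
      mean (swapRound I order (Bs.map (extendToBase I order))) fun A => ENNReal.ofReal (f A) := by
  have hpt : ∀ e, fractionalPoint k Bs e ≤
      fractionalPoint k (Bs.map (extendToBase I order)) e := fun e => by
    unfold fractionalPoint
    have := countP_mem_le_map hI order hBs e
    gcongr
  refine (ENNReal.ofReal_le_ofReal (multilinear_le_of_point_le (fractionalPoint_nonneg _ _)
    (fractionalPoint_le_one (by simp [hlen])) hpt hmono)).trans ?_
  have hbase : ∀ B ∈ Bs, I (extendToBase I order B) ∧ (extendToBase I order B).card = r :=
    fun B hB => ⟨indep_extendToBase hI order (hBs B hB),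
      card_extendToBase hI hIorder hrank hT hTr (hBs B hB)⟩
  cases Bs with
  | nil => simp at hlen; omega
  | cons B Bs =>
    rw [List.map_cons, swapRound]
    refine le_trans (le_of_eq ?_) (le_mean_swapRoundFrom hI hf hnd hIorder (k := k) (r := r)
      one_pos ?_ (hbase B (by simp)) ?_)
    · congr 2
      funext e
      unfold fractionalPoint
      rw [List.countP_cons]
      by_cases he : e ∈ extendToBase I order B <;> simp [he, add_comm]
    · rw [List.length_map, ← hlen, List.length_cons]; omega
    · intro D hD
      obtain ⟨D', hD', rfl⟩ := List.mem_map.1 hD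
      exact hbase D' (by simp [hD'])

end Rounding

end ContinuousGreedy

namespace ContinuousGreedy

open scoped ENNReal

variable {E : Type*} [DecidableEq E] {I : Finset E → Prop} [DecidablePred I]

/-! ### The approximation guarantee -/

section Guarantee

theorem stepCount_pos {ε : ℝ} (hε : 0 < ε) : 0 < stepCount ε :=
  Nat.ceil_pos.2 (by positivity)

theorem mem_support_output (hI : IsMatroid I) {f : Finset E → ℝ} {order : List E}
    (hIorder : ∀ A, I A → ∀ e ∈ A, e ∈ order) {r : ℕ}
    (hrank : ∀ A, I A → A.card ≤ r) {T : Finset E} (hT : I T) (hTr : T.card = r)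
    {ε : ℝ} (hε : 0 < ε) {A : Finset E} (hA : A ∈ (output I f order r ε).support) :
    I A ∧ A.card = r := by
  rw [output, run, PMF.mem_support_bind_iff] at hA
  obtain ⟨Bs, hBs, hA⟩ := hA
  obtain ⟨hlen, hBI⟩ := mem_support_steps hI.empty hBs
  have hbase : ∀ B ∈ Bs, I (extendToBase I order B) ∧ (extendToBase I order B).card = r :=
    fun B hB => ⟨indep_extendToBase hI order (hBI B hB),
      card_extendToBase hI hIorder hrank hT hTr (hBI B hB)⟩
  -- At least one step is made; this excludes the empty list, for which `swapRound` returns the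
  -- default `∅`.
  have := stepCount_pos hε
  cases Bs with
  | nil => simp at hlen; omega
  | cons B Bs =>
    rw [List.map_cons, swapRound] at hA
    refine mem_support_swapRoundFrom (hbase B (by simp)) ?_ hA
    intro D hD
    obtain ⟨D', hD', rfl⟩ := List.mem_map.1 hD
    exact hbase D' (by simp [hD'])

/-- The contraction of the optimality gap in `k` steps. -/
theorem gap_factor_le {k : ℕ} (hk : 20 ≤ k) :
    (1 / (1 + (1 - 3 / (k : ℝ)) / k)) ^ k ≤ 1 / Real.exp 1 + 4 / k := by
  have hk0 : (20 : ℝ) ≤ k := by exact_mod_cast hk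
  set δ := 1 / (k : ℝ) with hδ
  have hδ0 : 0 < δ := by positivity
  have hδ1 : δ ≤ 1 / 20 := one_div_le_one_div_of_le (by norm_num) hk0
  have hkδ : k * δ = 1 := by rw [hδ]; field_simp
  have e1 : (1 - 3 / (k : ℝ)) / k = δ - 3 * δ ^ 2 := by rw [hδ]; ring
  have e2 : 4 / (k : ℝ) = 4 * δ := by rw [hδ]; ring
  rw [e1, e2]
  set x := δ - 3 * δ ^ 2 with hx
  have hx0 : 0 ≤ x := by nlinarith
  have hx1 : x ≤ δ := by nlinarith
  -- With `t = x - x²`, `exp t ≤ 1 + t + t² ≤ 1 + x`. As `x = δ - 3δ²`, the exponent is at least `δ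
  -- - 4δ²`, and `k` factors give `exp (-1 + 4δ)`.
  have hstep : 1 / (1 + x) ≤ Real.exp (-(x - x ^ 2)) := by
    rw [Real.exp_neg, one_div]
    refine inv_anti₀ (Real.exp_pos _) ?_
    have ht0 : 0 ≤ x - x ^ 2 := by nlinarith
    have ht : |x - x ^ 2| ≤ 1 := by rw [abs_of_nonneg ht0]; nlinarith
    have := (abs_le.1 (Real.abs_exp_sub_one_sub_id_le ht)).2
    nlinarith
  have hx2 : x ^ 2 ≤ δ ^ 2 := pow_le_pow_left₀ hx0 hx1 2
  have hbound : Real.exp (-(x - x ^ 2)) ≤ Real.exp (-(δ - 4 * δ ^ 2)) :=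
    Real.exp_le_exp.2 (by linarith)
  have hexp1 : (Real.exp 1)⁻¹ ≤ 1 / 2 := by
    rw [← one_div]
    refine one_div_le_one_div_of_le (by norm_num) ?_
    have := Real.add_one_le_exp (1 : ℝ); linarith
  calc (1 / (1 + x)) ^ k ≤ Real.exp (-(δ - 4 * δ ^ 2)) ^ k :=
        pow_le_pow_left₀ (by positivity) (hstep.trans hbound) k
    _ = Real.exp (-1 + 4 * δ) := by
        rw [← Real.exp_nat_mul]
        congr 1
        linear_combination (-1 + 4 * δ) * hkδ
    _ = (Real.exp 1)⁻¹ * Real.exp (4 * δ) := by rw [Real.exp_add, Real.exp_neg]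
    _ ≤ (Real.exp 1)⁻¹ * (1 + 4 * δ + (4 * δ) ^ 2) := by
        refine mul_le_mul_of_nonneg_left ?_ (by positivity)
        have h4 : |4 * δ| ≤ 1 := by rw [abs_of_nonneg (by positivity)]; linarith
        have := (abs_le.1 (Real.abs_exp_sub_one_sub_id_le h4)).2
        linarith
    _ ≤ 1 / Real.exp 1 + 4 * δ := by
        rw [one_div]
        have := mul_le_mul_of_nonneg_right hexp1 (show 0 ≤ 4 * δ + (4 * δ) ^ 2 by positivity)
        nlinarith

/-- The union bound over all estimates of the algorithm. -/
theorem total_failure_le {n r k : ℕ} (hr : 0 < r) (hrn : r ≤ n) (hk : 2 ≤ k) :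
    (k : ℝ≥0∞) * (thresholdCount r k * (n * estimateFailure r k (sampleCount n r k))) ≤
      ENNReal.ofReal (1 / k) := by
  have hk0 : (2 : ℝ) ≤ k := by exact_mod_cast hk
  have hr0 : (1 : ℝ) ≤ r := by exact_mod_cast hr
  have hn0 : (r : ℝ) ≤ n := by exact_mod_cast hrn
  set p : ℝ := n * k with hp
  have hp2 : 2 ≤ p := by nlinarith
  have hexp : Real.exp (-(sampleCount n r k * (1 / (k : ℝ)) * (1 / (k : ℝ) / r))) ≤
      (p ^ 20)⁻¹ := by
    rw [Real.exp_neg]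
    refine inv_anti₀ (by positivity) ?_
    -- The failure exponent is `m / (r k²)`, and the sample count is chosen to make it at least `20
    -- log (n k)`.
    have h1 : 20 * Real.log p ≤ sampleCount n r k * (1 / (k : ℝ)) * (1 / (k : ℝ) / r) := by
      have h2 : 20 * (r : ℝ) * (k : ℝ) ^ 2 * Real.log p ≤ sampleCount n r k := Nat.le_ceil _
      have h3 : (sampleCount n r k : ℝ) * (1 / (k : ℝ)) * (1 / (k : ℝ) / r) =
          sampleCount n r k / (r * k ^ 2) := by field_simp
      rw [h3, le_div_iff₀ (by positivity)]
      linarith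
    calc p ^ 20 = Real.exp (20 * Real.log p) := by
          rw [mul_comm, Real.exp_mul, Real.exp_log (by linarith)]
          exact_mod_cast (Real.rpow_natCast p 20).symm
      _ ≤ _ := Real.exp_le_exp.2 h1
  have hcount : (thresholdCount r k : ℝ) ≤ k * (k * r) := by
    exact_mod_cast thresholdCount_le hr (by omega)
  have e1 : (k : ℝ≥0∞) * (thresholdCount r k * (n * estimateFailure r k (sampleCount n r k))) =
      ENNReal.ofReal (k * (thresholdCount r k * (n * (2 *
        Real.exp (-(sampleCount n r k * (1 / (k : ℝ)) * (1 / (k : ℝ) / r))))))) := by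
    unfold estimateFailure
    rw [ENNReal.ofReal_mul (by positivity), ENNReal.ofReal_mul (by positivity),
      ENNReal.ofReal_mul (by positivity), ENNReal.ofReal_mul (by positivity)]
    simp
  rw [e1]
  refine ENNReal.ofReal_le_ofReal ?_
  calc _ ≤ k * ((k * (k * r)) * (n * (2 * (p ^ 20)⁻¹))) := by gcongr
    _ ≤ k * ((k * (k * n)) * (n * (2 * (p ^ 20)⁻¹))) := by gcongr
    _ ≤ 1 / k := by
        have h5 : 2 * p ^ 4 ≤ p ^ 20 :=
          calc 2 * p ^ 4 ≤ p * p ^ 4 := by gcongr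
            _ = p ^ 5 := by ring
            _ ≤ p ^ 20 := pow_le_pow_right₀ (by linarith) (by norm_num)
        have h6 : 2 * ((k : ℝ) ^ 4 * (n : ℝ) ^ 2) ≤ p ^ 20 := by
          refine le_trans ?_ h5
          rw [hp, mul_pow]
          have : (n : ℝ) ^ 2 ≤ (n : ℝ) ^ 4 := pow_le_pow_right₀ (by linarith) (by norm_num)
          have h7 := mul_le_mul_of_nonneg_left this (show 0 ≤ (k : ℝ) ^ 4 by positivity)
          linarith
        have hppos : 0 < p ^ 20 := by positivity
        rw [le_div_iff₀ (by linarith)]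
        calc _ = 2 * ((k : ℝ) ^ 4 * (n : ℝ) ^ 2) / p ^ 20 := by ring
          _ ≤ 1 := (div_le_one hppos).2 h6

/-- The approximation guarantee of the accelerated continuous greedy algorithm. -/
theorem le_mean_output (hI : IsMatroid I) {f : Finset E → ℝ} (hf : DecreasingMarginals f)
    (hmono : Monotone f) (hf0 : f ∅ = 0) {order : List E} (hnd : order.Nodup)
    (hIorder : ∀ A, I A → ∀ e ∈ A, e ∈ order) {r : ℕ} (hrank : ∀ A, I A → A.card ≤ r)
    {T : Finset E} (hT : I T) (hTr : T.card = r) (hopt : ∀ A, I A → f A ≤ f T)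
    {ε : ℝ} (hε : 0 < ε) :
    ENNReal.ofReal ((1 - 1 / Real.exp 1 - ε) * f T) ≤
      mean (output I f order r ε) fun A => ENNReal.ofReal (f A) := by
  have hfT : 0 ≤ f T := hf0 ▸ hopt ∅ hI.empty
  have hexp1 : 1 / Real.exp 1 ≤ 1 / 2 := by
    refine one_div_le_one_div_of_le (by norm_num) ?_
    have := Real.add_one_le_exp (1 : ℝ); linarith
  have hexp0 : 0 < 1 / Real.exp 1 := by positivity
  -- For `ε > 1` the factor is negative and the bound trivial; otherwise `k ≥ 20`.
  by_cases hε1 : 1 < ε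
  · rw [ENNReal.ofReal_eq_zero.2 (mul_nonpos_of_nonpos_of_nonneg (by linarith) hfT)]
    exact zero_le
  -- If all independent singletons have value at most zero, submodularity forces `f T = 0`.
  rcases (maxSingleton_nonneg (I := I) f order).eq_or_lt with hd | hd
  · have h1 := hf.le_sum ∅ T
    have h2 : ∑ o ∈ T, (f (insert o ∅) - f ∅) ≤ 0 := Finset.sum_nonpos fun o ho => by
      rw [insert_empty_eq, hf0, sub_zero, hd]
      exact le_maxSingleton f (hIorder _ hT o ho)
        (hI.subset hT (Finset.singleton_subset_iff.2 ho))
    rw [Finset.empty_union] at h1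
    have h3 : f T = 0 := by linarith
    rw [h3, mul_zero, ENNReal.ofReal_zero]
    exact zero_le
  have hdT : maxSingleton I f order ≤ f T := maxSingleton_le hfT fun e he => hopt _ he
  have hr : 0 < r := by
    rcases Nat.eq_zero_or_pos r with h0 | h0
    · rw [h0, Finset.card_eq_zero] at hTr
      rw [hTr, hf0] at hdT
      exact absurd hdT (not_le.2 hd)
    · exact h0
  set k := stepCount ε with hk_def
  have hkε : 20 / ε ≤ k := Nat.le_ceil _
  have hk20 : (20 : ℝ) ≤ k := by
    refine le_trans ?_ hkε
    rw [le_div_iff₀ hε]; nlinarith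
  have hk : 20 ≤ k := by exact_mod_cast hk20
  have hrn : r ≤ order.length := by
    rw [← hTr]
    refine le_trans (Finset.card_le_card fun e he => ?_) (List.toFinset_card_le order)
    exact List.mem_toFinset.2 (hIorder _ hT e he)
  have hn0 : (1 : ℝ) ≤ order.length := by exact_mod_cast hr.trans_le hrn
  have hm : 0 < sampleCount order.length r k := by
    refine Nat.ceil_pos.2 ?_
    have : 0 < Real.log (order.length * k) := Real.log_pos (by nlinarith)
    have : (0 : ℝ) < r := Nat.cast_pos.2 hr
    positivity
  have key := (steps_holds hf hmono hf0 hnd hIorder hr (by omega : 3 ≤ k) hm hI hrank hT hTr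
    hd hdT le_rfl).mono (total_failure_le hr hrn (by omega : 2 ≤ k)) fun _ h => h
  set δ := 1 / (k : ℝ) with hδ
  have hδ0 : 0 < δ := by positivity
  have hδ1 : δ ≤ 1 / 20 := one_div_le_one_div_of_le (by norm_num) hk20
  have hδε : 20 * δ ≤ ε := by
    rw [hδ, mul_one_div, div_le_iff₀ (by linarith)]
    rw [div_le_iff₀ hε] at hkε
    linarith
  -- Of the `7δ`, `4δ` comes from the contraction factor and `3δ` from the additive errors of the
  -- `k` steps. The failure probability costs at most another `δ`, well within `20δ ≤ ε`.
  set c := (1 - 1 / Real.exp 1 - 7 * δ) * f T with hc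
  have hc0 : 0 ≤ c := mul_nonneg (by linarith) hfT
  have main := key.le_mean (c := ENNReal.ofReal c) (g := fun Bs => mean
    (swapRound I order (Bs.map (extendToBase I order))) fun A => ENNReal.ofReal (f A))
    fun Bs hBs hQ => by
      refine le_trans (ENNReal.ofReal_le_ofReal ?_) (le_mean_swapRound hI hf hmono hnd hIorder
        (by omega : 0 < k) hrank hT hTr hQ.1 (mem_support_steps hI.empty hBs).2)
      have h1 := mul_le_mul_of_nonneg_right (gap_factor_le hk) hfT
      have h2 := hQ.2
      have e1 : (k : ℝ) * (3 / k / k * f T) = 3 * δ * f T := by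
        rw [hδ]; field_simp
      have e2 : 4 / (k : ℝ) = 4 * δ := by rw [hδ]; ring
      rw [e1] at h2
      rw [e2] at h1
      rw [hc]
      linarith
  rw [output, run, mean_bind, ← hk_def]
  refine le_trans ?_ (tsub_le_iff_right.2 main)
  rw [← ENNReal.ofReal_mul hc0, ← ENNReal.ofReal_sub _ (by positivity)]
  refine ENNReal.ofReal_le_ofReal ?_
  have e3 : c - c * δ = ((1 - 1 / Real.exp 1 - 7 * δ) * (1 - δ)) * f T := by rw [hc]; ring
  rw [e3]
  refine mul_le_mul_of_nonneg_right ?_ hfT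
  nlinarith

end Guarantee

end ContinuousGreedy

namespace RedundantAssignment

open ContinuousGreedy
open scoped ENNReal

variable {N M : ℕ}

/-! ### The matroid of redundant assignments -/

section Constraint

theorem robotsOnce_iff {S : Finset (Edge N M)} :
    RobotsOnce S ↔ ∀ x ∈ S, ∀ y ∈ S, x.1 = y.1 → x = y := by
  unfold RobotsOnce
  simp only [Finset.card_le_one, Finset.mem_filter, Finset.mem_univ, true_and]
  constructor
  · rintro h ⟨i, j⟩ hx ⟨i', j'⟩ hy (rfl : i = i')
    rw [h i j hx j' hy]
  · intro h i j hj j' hj'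
    exact congrArg Prod.snd (h _ hj _ hj' rfl)

theorem robotsOnce_insert_union {O A : Finset (Edge N M)} {e : Edge N M}
    (hA : RobotsOnce (A ∪ O)) (he : ∀ x ∈ A ∪ O, x.1 = e.1 → x = e) :
    RobotsOnce (insert e A ∪ O) := by
  rw [robotsOnce_iff] at *
  rw [Finset.insert_union]
  intro x hx y hy hxy
  rcases Finset.mem_insert.1 hx with rfl | hx' <;> rcases Finset.mem_insert.1 hy with rfl | hy'
  · rfl
  · exact (he y hy' hxy.symm).symm
  · exact he x hx' hxy
  · exact hA x hx' y hy' hxy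

theorem Indep.mono {Nd : ℕ} {O A B : Finset (Edge N M)} (hB : Indep Nd O B) (h : A ⊆ B) :
    Indep Nd O A := by
  refine ⟨h.trans hB.1, (Finset.card_le_card h).trans hB.2.1, ?_⟩
  have := hB.2.2
  rw [robotsOnce_iff] at *
  have hs : A ∪ O ⊆ B ∪ O := Finset.union_subset_union_left h
  exact fun x hx y hy => this x (hs hx) y (hs hy)

theorem Indep.injOn {Nd : ℕ} {O A : Finset (Edge N M)} (hA : Indep Nd O A) :
    Set.InjOn Prod.fst (A : Set (Edge N M)) := fun x hx y hy =>
  robotsOnce_iff.1 hA.2.2 x (Finset.mem_union_left _ hx) y (Finset.mem_union_left _ hy)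

theorem Indep.insert {Nd : ℕ} {O A B : Finset (Edge N M)} {e : Edge N M} (hA : Indep Nd O A)
    (hB : Indep Nd O B) (he : e ∈ B) (hcard : A.card < Nd - M) (hne : ∀ x ∈ A, x.1 ≠ e.1) :
    Indep Nd O (insert e A) := by
  refine ⟨Finset.insert_subset (hB.1 he) hA.1, (Finset.card_insert_le _ _).trans hcard,
    robotsOnce_insert_union hA.2.2 fun x hx hxe => ?_⟩
  rcases Finset.mem_union.1 hx with hx | hx
  · exact absurd hxe (hne x hx)
  · exact robotsOnce_iff.1 hB.2.2 x (Finset.mem_union_right _ hx) e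
      (Finset.mem_union_left _ he) hxe

theorem Indep.insert_erase {Nd : ℕ} {O A B : Finset (Edge N M)} {i j : Edge N M}
    (hA : Indep Nd O A) (hi : i ∈ A) (hB : Indep Nd O B) (hj : j ∈ B)
    (hne : ∀ x ∈ A, x ≠ i → x.1 ≠ j.1) : Indep Nd O (Insert.insert j (A.erase i)) := by
  refine (hA.mono (Finset.erase_subset i A)).insert hB hj ?_ fun x hx =>
    hne x (Finset.mem_of_mem_erase hx) (Finset.ne_of_mem_erase hx)
  exact (Finset.card_erase_lt_of_mem hi).trans_le hA.2.1

/-- The constraint of the assignment problem is a truncated partition matroid. -/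
theorem isMatroid_indep {Nd : ℕ} {O : Finset (Edge N M)} (hO : RobotsOnce O) :
    IsMatroid (Indep Nd O) where
  empty := ⟨Finset.empty_subset _, by simp, by rwa [Finset.empty_union]⟩
  subset hB h := hB.mono h
  augment {A B} hA hB hcard := by
    -- Independent sets use distinct robots, so the larger set uses a robot that the smaller one
    -- does not.
    have h : (A.image Prod.fst).card < (B.image Prod.fst).card := by
      rw [Finset.card_image_of_injOn hB.injOn]
      exact Finset.card_image_le.trans_lt hcard
    obtain ⟨a, haB, haA⟩ := Finset.exists_mem_notMem_of_card_lt_card h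
    obtain ⟨e, he, rfl⟩ := Finset.mem_image.1 haB
    have hne : ∀ x ∈ A, x.1 ≠ e.1 := fun x hx h => haA (Finset.mem_image.2 ⟨x, hx, h⟩)
    exact ⟨e, he, fun h => hne e h rfl, hA.insert hB he (hcard.trans_le hB.2.1) hne⟩
  exchange {A B} hA hB hcard hne := by
    obtain ⟨i, hi⟩ : (A \ B).Nonempty := by
      rw [Finset.nonempty_iff_ne_empty, Ne, Finset.sdiff_eq_empty_iff_subset]
      exact fun h => hne (Finset.eq_of_subset_of_card_le h hcard.ge)
    have hi' := Finset.mem_sdiff.1 hi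
    refine ⟨i, hi, ?_⟩
    -- If `B` uses the robot of `i`, the two edges of that robot are swapped. Otherwise `B`, which
    -- uses as many robots as `A`, has a robot unknown to `A`, and its edge is swapped with `i`.
    by_cases h : ∃ j ∈ B, j.1 = i.1
    · obtain ⟨j, hj, hji⟩ := h
      have hjA : j ∉ A := fun h => hi'.2 (hA.injOn h hi'.1 hji ▸ hj)
      exact ⟨j, Finset.mem_sdiff.2 ⟨hj, hjA⟩,
        hA.insert_erase hi'.1 hB hj fun x hx hxi h => hxi (hA.injOn hx hi'.1 (h.trans hji)),
        hB.insert_erase hj hA hi'.1 fun x hx hxj h => hxj (hB.injOn hx hj (h.trans hji.symm))⟩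
    · push Not at h
      have himg : ¬ B.image Prod.fst ⊆ A.image Prod.fst := fun hsub => by
        have heq := Finset.eq_of_subset_of_card_le hsub (by
          rw [Finset.card_image_of_injOn hA.injOn, Finset.card_image_of_injOn hB.injOn, hcard])
        have : i.1 ∈ B.image Prod.fst := heq ▸ Finset.mem_image_of_mem _ hi'.1
        obtain ⟨j, hj, hji⟩ := Finset.mem_image.1 this
        exact h j hj hji
      obtain ⟨a, haB, haA⟩ := Finset.not_subset.1 himg
      obtain ⟨j, hj, rfl⟩ := Finset.mem_image.1 haB
      have hjA : ∀ x ∈ A, x.1 ≠ j.1 := fun x hx hxj => haA (Finset.mem_image.2 ⟨x, hx, hxj⟩)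
      exact ⟨j, Finset.mem_sdiff.2 ⟨hj, fun hjA' => hjA j hjA' rfl⟩,
        hA.insert_erase hi'.1 hB hj fun x hx _ => hjA x hx,
        hB.insert_erase hj hA hi'.1 fun x hx _ => h x hx⟩

theorem feasible_iff {Nd : ℕ} {O A : Finset (Edge N M)} :
    Feasible Nd O A ↔ Indep Nd O A ∧ A.card = Nd - M :=
  ⟨fun h => ⟨⟨h.1, h.2.2.le, h.2.1⟩, h.2.2⟩, fun h => ⟨h.1.1, h.1.2.2, h.2⟩⟩

theorem IsInitialAssignment.card_le {O : Finset (Edge N M)} (hO : IsInitialAssignment O) :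
    O.card ≤ M := by
  have : Set.InjOn Prod.snd (O : Set (Edge N M)) := by
    rintro ⟨i, j⟩ hx ⟨i', j'⟩ hy (rfl : j = j')
    have h := Finset.card_le_one.1 (hO.1 j).le i (by simpa using hx) i' (by simpa using hy)
    rw [h]
  simpa using Finset.card_le_card_of_injOn Prod.snd (t := (Finset.univ : Finset (Fin M)))
    (fun _ _ => Finset.mem_univ _) this

/-- At least `N - M` robots are not used by `O`; `Nd - M` of them can all be sent to the goal with
index `0`. -/
theorem exists_feasible {Nd : ℕ} (hM : 0 < M) (hNdN : Nd ≤ N) {O : Finset (Edge N M)}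
    (hO : IsInitialAssignment O) : ∃ T, Feasible Nd O T := by
  have hfree : Nd - M ≤ (Finset.univ \ O.image Prod.fst : Finset (Fin N)).card := by
    rw [Finset.card_sdiff_of_subset (Finset.subset_univ _), Finset.card_univ, Fintype.card_fin]
    have := (Finset.card_image_le (s := O) (f := Prod.fst)).trans hO.card_le
    omega
  obtain ⟨U, hU, hUc⟩ := Finset.exists_subset_card_eq hfree
  have hUO : ∀ i ∈ U, ∀ x ∈ O, x.1 ≠ i := fun i hi x hx h =>
    (Finset.mem_sdiff.1 (hU hi)).2 (Finset.mem_image.2 ⟨x, hx, h⟩)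
  refine ⟨U.image fun i => (i, ⟨0, hM⟩), fun x hx => ?_, robotsOnce_iff.2 fun x hx y hy h => ?_, ?_⟩
  · obtain ⟨i, hi, rfl⟩ := Finset.mem_image.1 hx
    exact Finset.mem_sdiff.2 ⟨Finset.mem_univ _, fun h => hUO i hi _ h rfl⟩
  · rcases Finset.mem_union.1 hx with hx | hx <;> rcases Finset.mem_union.1 hy with hy | hy
    · obtain ⟨i, hi, rfl⟩ := Finset.mem_image.1 hx
      obtain ⟨i', hi', rfl⟩ := Finset.mem_image.1 hy
      rw [show i = i' from h]
    · obtain ⟨i, hi, rfl⟩ := Finset.mem_image.1 hx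
      exact absurd h.symm (hUO i hi y hy)
    · obtain ⟨i, hi, rfl⟩ := Finset.mem_image.1 hy
      exact absurd h (hUO i hi x hx)
    · exact robotsOnce_iff.1 hO.2 x hx y hy h
  · rw [Finset.card_image_of_injective _ fun a b h => congrArg Prod.fst h, hUc]

end Constraint

/-! ### Monotonicity and submodularity of the cost reduction -/

section Objective

variable {Ω : Type*} {C : Fin N → Fin M → Ω → ℝ}
  {O : Finset (Edge N M)}

theorem incident_union_nonempty (hO : IsInitialAssignment O) (A : Finset (Edge N M)) (j : Fin M) :
    (incident (A ∪ O) j).Nonempty := by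
  have : 0 < (Finset.univ.filter fun i : Fin N => (i, j) ∈ O).card := by rw [hO.1 j]; exact one_pos
  obtain ⟨i, hi⟩ := Finset.card_pos.1 this
  exact ⟨(i, j), Finset.mem_filter.2
    ⟨Finset.mem_union_right _ (Finset.mem_filter.1 hi).2, rfl⟩⟩

theorem effectiveWait_anti {S T : Finset (Edge N M)} (hS : S.Nonempty) (h : S ⊆ T) (ω : Ω) :
    effectiveWait C T ω ≤ effectiveWait C S ω := by
  unfold effectiveWait
  rw [dif_pos hS, dif_pos (hS.mono h)]
  exact Finset.inf'_mono _ h hS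

theorem effectiveWait_insert {S : Finset (Edge N M)} (hS : S.Nonempty) (e : Edge N M) (ω : Ω) :
    effectiveWait C (insert e S) ω = min (C e.1 e.2 ω) (effectiveWait C S ω) := by
  unfold effectiveWait
  rw [dif_pos hS, dif_pos (Finset.insert_nonempty e S), Finset.inf'_insert hS]

theorem incident_insert_union (A : Finset (Edge N M)) (e : Edge N M) (j : Fin M) :
    incident (insert e A ∪ O) j =
      if e.2 = j then insert e (incident (A ∪ O) j) else incident (A ∪ O) j := by
  unfold incident
  rw [Finset.insert_union, Finset.filter_insert]

/-- Submodularity in each outcome: only the goal of `e` is affected, and there the decrease `w - min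
c w` is monotone in the current waiting time `w`. -/
theorem effectiveWait_decrease_anti (hO : IsInitialAssignment O) {S T : Finset (Edge N M)}
    (h : S ⊆ T) (e : Edge N M) (j : Fin M) (ω : Ω) :
    effectiveWait C (incident (T ∪ O) j) ω - effectiveWait C (incident (insert e T ∪ O) j) ω ≤
      effectiveWait C (incident (S ∪ O) j) ω - effectiveWait C (incident (insert e S ∪ O) j) ω := by
  rw [incident_insert_union, incident_insert_union]
  split_ifs
  · rw [effectiveWait_insert (incident_union_nonempty hO T j),
      effectiveWait_insert (incident_union_nonempty hO S j)]
    have := effectiveWait_anti (C := C) (incident_union_nonempty hO S j)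
      (Finset.filter_subset_filter _ (Finset.union_subset_union_left h)) ω (T := incident (T ∪ O) j)
    rcases min_cases (C e.1 e.2 ω) (effectiveWait C (incident (S ∪ O) j) ω) with h1 | h1 <;>
    rcases min_cases (C e.1 e.2 ω) (effectiveWait C (incident (T ∪ O) j) ω) with h2 | h2 <;>
    linarith
  · simp

variable [MeasurableSpace Ω] {P : Measure Ω}

theorem cost_sub_cost (hint : ∀ A ⊆ ground O, ∀ j : Fin M,
      Integrable (effectiveWait C (incident (A ∪ O) j)) P) (A B : Finset (Edge N M)) :
    (∀ j, Integrable (fun ω => effectiveWait C (incident (A ∪ O) j) ω -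
        effectiveWait C (incident (B ∪ O) j) ω) P) ∧
      cost P C O A - cost P C O B = 1 / (M : ℝ) * ∑ j : Fin M,
        ∫ ω, (effectiveWait C (incident (A ∪ O) j) ω -
          effectiveWait C (incident (B ∪ O) j) ω) ∂P := by
  -- The objective depends on `A ∪ O` alone, so `A` may be replaced by `A \ O`; monotonicity and
  -- submodularity then hold on all edge sets.
  have hint' : ∀ A : Finset (Edge N M), ∀ j, Integrable (effectiveWait C (incident (A ∪ O) j)) P :=
    fun A j => by
      have := hint (A \ O) (Finset.sdiff_subset_sdiff (Finset.subset_univ _) subset_rfl) j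
      rwa [Finset.sdiff_union_self_eq_union] at this
  refine ⟨fun j => (hint' A j).sub (hint' B j), ?_⟩
  unfold cost
  rw [← mul_sub, ← Finset.sum_sub_distrib]
  congr 1
  exact Finset.sum_congr rfl fun j _ => (integral_sub (hint' A j) (hint' B j)).symm

theorem cost_antitone (hO : IsInitialAssignment O) (hint : ∀ A ⊆ ground O, ∀ j : Fin M,
      Integrable (effectiveWait C (incident (A ∪ O) j)) P) : Antitone (cost P C O) := by
  intro A B h
  rw [← sub_nonneg, (cost_sub_cost hint A B).2]
  refine mul_nonneg (by positivity) (Finset.sum_nonneg fun j _ => integral_nonneg fun ω => ?_)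
  exact sub_nonneg.2 (effectiveWait_anti (incident_union_nonempty hO A j)
    (Finset.filter_subset_filter _ (Finset.union_subset_union_left h)) ω)

theorem decreasingMarginals_costReduction (hO : IsInitialAssignment O)
    (hint : ∀ A ⊆ ground O, ∀ j : Fin M,
      Integrable (effectiveWait C (incident (A ∪ O) j)) P) :
    DecreasingMarginals fun A => baseCost P C O - cost P C O A := by
  intro S T e h
  have hS := cost_sub_cost hint S (insert e S)
  have hT := cost_sub_cost hint T (insert e T)
  have : cost P C O T - cost P C O (insert e T) ≤ cost P C O S - cost P C O (insert e S) := by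
    rw [hS.2, hT.2]
    refine mul_le_mul_of_nonneg_left (Finset.sum_le_sum fun j _ => ?_) (by positivity)
    exact integral_mono (hT.1 j) (hS.1 j) fun ω => effectiveWait_decrease_anti hO h e j ω
  dsimp only
  linarith

end Objective

/-! ### The discrete greedy algorithm -/

section Greedy

variable {Ω : Type*} [MeasurableSpace Ω] {P : Measure Ω} {C : Fin N → Fin M → Ω → ℝ}
  {O : Finset (Edge N M)} {Nd : ℕ}

theorem mem_eligible {A : Finset (Edge N M)} {x : Edge N M} :
    x ∈ eligible Nd O A ↔ x ∉ A ∧ Indep Nd O (insert x A) := by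
  unfold eligible
  rw [Finset.mem_filter, Finset.mem_sdiff]
  exact ⟨fun h => ⟨h.1.2, h.2⟩, fun h => ⟨⟨h.2.1 (Finset.mem_insert_self _ _), h.1⟩, h.2⟩⟩

theorem exists_greedyRun (t : ℕ) : ∃ A, GreedyRun P C Nd O t A := by
  induction t with
  | zero => exact ⟨∅, .init⟩
  | succ t ih =>
    obtain ⟨A, hA⟩ := ih
    rcases (eligible Nd O A).eq_empty_or_nonempty with h | h
    · exact ⟨A, .idle t A hA h⟩
    · obtain ⟨a, ha, hmax⟩ := Finset.exists_max_image _ (marginalDecrease P C O A) h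
      exact ⟨_, .add t A a hA ha hmax⟩

/-- As a feasible `T` exists, augmentation leaves an eligible element as long as `A` has fewer than
`Nd - M` elements; idling occurs only at full size. -/
theorem GreedyRun.spec (hO : RobotsOnce O) {T : Finset (Edge N M)} (hT : Feasible Nd O T)
    {t : ℕ} {A : Finset (Edge N M)} (hA : GreedyRun P C Nd O t A) :
    A.card = min t (Nd - M) ∧ GreedyChain (Indep Nd O) (fun A => baseCost P C O - cost P C O A)
      (fun A o => (baseCost P C O - cost P C O (insert o A)) - (baseCost P C O - cost P C O A))
      A := by
  induction hA with
  | init => exact ⟨by simp, .empty⟩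
  | add t A a hA ha hmax ih =>
    rw [mem_eligible] at ha
    have hcard := ha.2.2.1
    rw [Finset.card_insert_of_notMem ha.1] at *
    refine ⟨by omega, .extend A a ih.2 ha.1 ha.2 fun o ho hIo => ?_⟩
    have := hmax o (mem_eligible.2 ⟨ho, hIo⟩)
    unfold marginalDecrease at this
    linarith
  | idle t A hA hnone ih =>
    refine ⟨?_, ih.2⟩
    have hT' := feasible_iff.1 hT
    have hI := ih.2.indep (isMatroid_indep hO)
    have : ¬ A.card < T.card := fun hlt => by
      obtain ⟨e, _, he, hIe⟩ := (isMatroid_indep hO).augment hI hT'.1 hlt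
      have := mem_eligible.2 ⟨he, hIe⟩
      rw [hnone] at this
      exact absurd this (Finset.notMem_empty e)
    have := hI.2.1
    omega

end Greedy

end RedundantAssignment

/-! ### From reductions back to costs -/

namespace RedundantAssignment

open ContinuousGreedy
open scoped ENNReal

variable {N M : ℕ}

theorem le_sum_toReal_mul {α : Type*} [Fintype α] {p : PMF α} {g : α → ℝ} (hg : ∀ a, 0 ≤ g a)
    {c : ℝ} (h : ENNReal.ofReal c ≤ mean p fun a => ENNReal.ofReal (g a)) :
    c ≤ ∑ a, (p a).toReal * g a := by
  have e : (mean p fun a => ENNReal.ofReal (g a)) = ENNReal.ofReal (∑ a, (p a).toReal * g a) := by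
    unfold mean
    rw [tsum_fintype, ENNReal.ofReal_sum_of_nonneg fun a _ =>
      mul_nonneg ENNReal.toReal_nonneg (hg a)]
    refine Finset.sum_congr rfl fun a _ => ?_
    rw [ENNReal.ofReal_mul ENNReal.toReal_nonneg, ENNReal.ofReal_toReal (p.apply_ne_top a)]
  rw [e] at h
  exact (ENNReal.ofReal_le_ofReal_iff (Finset.sum_nonneg fun a _ =>
    mul_nonneg ENNReal.toReal_nonneg (hg a))).1 h

theorem sum_toReal_eq_one {α : Type*} [Fintype α] (p : PMF α) : ∑ a, (p a).toReal = 1 := by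
  rw [← ENNReal.toReal_sum fun a _ => p.apply_ne_top a, ← tsum_fintype (L := .unconditional _),
    p.tsum_coe, ENNReal.toReal_one]

/-- By monotonicity this makes an optimal feasible set optimal among all independent sets, as the
continuous greedy guarantee demands. -/
theorem exists_feasible_superset {Nd : ℕ} {O A T : Finset (Edge N M)} (hO : RobotsOnce O)
    (hT : Feasible Nd O T) (hA : Indep Nd O A) : ∃ B, Feasible Nd O B ∧ A ⊆ B := by
  have hT' := feasible_iff.1 hT
  refine ⟨extendToBase (Indep Nd O) Finset.univ.toList A, feasible_iff.2 ⟨?_, ?_⟩, ?_⟩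
  · exact indep_extendToBase (isMatroid_indep hO) _ hA
  · exact card_extendToBase (isMatroid_indep hO) (fun _ _ e _ => by simp) (fun _ h => h.2.1)
      hT'.1 hT'.2 hA
  · exact subset_extendToBase (isMatroid_indep hO) _ hA

end RedundantAssignment

theorem theorem2 {Ω : Type*} [MeasurableSpace Ω] (P : Measure Ω) [IsProbabilityMeasure P]
    {N M Nd : ℕ} (hM : 0 < M) (hMNd : M ≤ Nd) (hNdN : Nd ≤ N)
    (C : Fin N → Fin M → Ω → ℝ) (hC : ∀ i j, AEMeasurable (C i j) P)
    (O : Finset (RedundantAssignment.Edge N M)) (hO : RedundantAssignment.IsInitialAssignment O)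
    -- all expectations that the objective evaluates exist and are finite
    (hint : ∀ A ⊆ RedundantAssignment.ground O, ∀ j : Fin M,
      Integrable (RedundantAssignment.effectiveWait C
        (RedundantAssignment.incident (A ∪ O) j)) P) :
    -- the optimal value is attained, and the non-redundant cost is the maximum possible cost
    IsLeast (RedundantAssignment.cost P C O '' {A | RedundantAssignment.Feasible Nd O A})
      (RedundantAssignment.optimalCost P C Nd O) ∧
    (∀ A ⊆ RedundantAssignment.ground O,
      RedundantAssignment.cost P C O A ≤ RedundantAssignment.baseCost P C O) ∧
    -- the greedy algorithm, for every way of breaking ties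
    (∃ A, RedundantAssignment.GreedyOutput P C Nd O A) ∧
    (∀ A, RedundantAssignment.GreedyOutput P C Nd O A →
      RedundantAssignment.Feasible Nd O A ∧
      RedundantAssignment.cost P C O A ≤
        1 / 2 * (RedundantAssignment.optimalCost P C Nd O + RedundantAssignment.baseCost P C O)) ∧
    -- the randomized continuous greedy algorithm, for every enumeration of the ground set
    (∀ ε : ℝ, 0 < ε → ∀ order : List (RedundantAssignment.Edge N M), order.Nodup →
      (∀ e, e ∈ order ↔ e ∈ RedundantAssignment.ground O) →
      (∀ A ∈ (RedundantAssignment.continuousGreedyOutput P C Nd O order ε).support,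
        RedundantAssignment.Feasible Nd O A) ∧
      ∑ A : Finset (RedundantAssignment.Edge N M),
          (RedundantAssignment.continuousGreedyOutput P C Nd O order ε A).toReal *
            RedundantAssignment.cost P C O A ≤
        (1 - 1 / Real.exp 1 - ε) * RedundantAssignment.optimalCost P C Nd O +
          (1 / Real.exp 1 + ε) * RedundantAssignment.baseCost P C O) := by
  obtain ⟨T₀, hT₀⟩ := RedundantAssignment.exists_feasible hM hNdN hO
  have hleast : IsLeast (RedundantAssignment.cost P C O '' {A | RedundantAssignment.Feasible Nd O A})
      (RedundantAssignment.optimalCost P C Nd O) := by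
    have hfin := (Set.toFinite {A | RedundantAssignment.Feasible Nd O A}).image
      (RedundantAssignment.cost P C O)
    exact ⟨Set.Nonempty.csInf_mem ⟨_, T₀, hT₀, rfl⟩ hfin, fun x hx => csInf_le hfin.bddBelow hx⟩
  have hanti := RedundantAssignment.cost_antitone hO hint
  have hsub := RedundantAssignment.decreasingMarginals_costReduction hO hint
  have hmono : Monotone fun A => RedundantAssignment.baseCost P C O -
      RedundantAssignment.cost P C O A := fun A B h => sub_le_sub_left (hanti h) _
  have hzero : RedundantAssignment.baseCost P C O - RedundantAssignment.cost P C O ∅ = 0 :=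
    sub_self _
  have hmat := RedundantAssignment.isMatroid_indep (Nd := Nd) hO.2
  obtain ⟨T, hT, hTopt⟩ := hleast.1
  have hT' := RedundantAssignment.feasible_iff.1 hT
  have hbase : ∀ A, RedundantAssignment.cost P C O A ≤ RedundantAssignment.baseCost P C O :=
    fun A => hanti (Finset.empty_subset A)
  refine ⟨hleast, fun A _ => hbase A, RedundantAssignment.exists_greedyRun Nd,
    fun A hA => ?_, fun ε hε order hnd horder => ?_⟩
  · obtain ⟨hcard, hchain⟩ := RedundantAssignment.GreedyRun.spec hO.2 hT hA
    have hfeas : RedundantAssignment.Feasible Nd O A :=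
      RedundantAssignment.feasible_iff.2 ⟨hchain.indep hmat, by omega⟩
    refine ⟨hfeas, ?_⟩
    -- In terms of costs, `J₀ - J⋆ ≤ 2 (J₀ - J(A))` rearranges to the claim.
    have := hsub.le_of_greedyChain hmat hmono hzero hchain hT'.1 (hT'.2.trans hfeas.2.2.symm)
    rw [hTopt] at this
    linarith
  · have hIorder : ∀ A, RedundantAssignment.Indep Nd O A → ∀ e ∈ A, e ∈ order :=
      fun A hA e he => (horder e).2 (hA.1 he)
    refine ⟨fun A hA => RedundantAssignment.feasible_iff.2 (ContinuousGreedy.mem_support_output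
      hmat hIorder (fun _ h => h.2.1) hT'.1 hT'.2 hε hA), ?_⟩
    have key := RedundantAssignment.le_sum_toReal_mul (fun A => sub_nonneg.2 (hbase A))
      (ContinuousGreedy.le_mean_output hmat hsub hmono hzero hnd hIorder (fun _ h => h.2.1)
        hT'.1 hT'.2 (fun A hA => by
          obtain ⟨B, hB, hAB⟩ := RedundantAssignment.exists_feasible_superset hO.2 hT hA
          have h1 := hmono hAB
          have h2 := hleast.2 ⟨B, hB, rfl⟩
          dsimp only at h1 ⊢
          rw [hTopt]
          linarith) hε)
    rw [hTopt] at key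
    have hsum := RedundantAssignment.sum_toReal_eq_one
      (RedundantAssignment.continuousGreedyOutput P C Nd O order ε)
    -- The probabilities sum to one, so the expected reduction is `J₀` minus the expected cost.
    simp only [mul_sub, Finset.sum_sub_distrib, ← Finset.sum_mul] at key
    unfold RedundantAssignment.continuousGreedyOutput at hsum ⊢
    rw [hsum] at key
    linarith
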